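/- Let $n\ge 1$ and let $q:\mathbb Z^n\to\mathbb Z$ be a connected non-negative unit form: $q(x)=\sum_i x_i^2+\sum_{i<j}q_{ij}x_ix_j$ with $q_{ij}\in\mathbb Z$, $q(x)\ge 0$ for all $x$, and the graph on $\{1,\dots,n\}$ with an edge $ij$ whenever $q_{ij}\neq 0$ is connected. Write $q(x,y)=q(x+y)-q(x)-q(y)$, extended bilinearly to $\mathbb C^n$; let $\operatorname{rad}q=\{x\in\mathbb Z^n: q(x,-)=0\}=q^{-1}(0)$, let the corank of $q$ be the rank of $\operatorname{rad}q$, let $\operatorname{rad}_{\mathbb C}q\subseteq\mathbb C^n$ be the complex span of $\operatorname{rad} q$, and let $R(q)=q^{-1}(0)\cup q^{-1}(1)$. Let $B$ be any bilinear form $\mathbb Z^n\times\mathbb Z^n\to\mathbb Z$ with $B(x,x)=q(x)$, put $\epsilon(\alpha,\beta)=(-1)^{B(\alpha,\beta)}$, and let $\rho:\mathbb C^n\to\operatorname{rad}_{\mathbb C}q$ be any linear projection. Let $E=E(q)=\bigoplus_{\alpha\in R(q)}E_\alpha$ with $E_\alpha=\mathbb C e_\alpha$ if $q(\alpha)=1$,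 $E_\alpha=\mathbb C^n/\operatorname{rad}_{\mathbb C}q$ if $0\ne\alpha\in\operatorname{rad}q$, and $E_0=\mathbb C^n\oplus(\operatorname{rad}_{\mathbb C}q)^*$. Write $\pi_\sigma:\mathbb C^n\to E_\sigma$ for the canonical projection when $0\neq\sigma\in\operatorname{rad}q$, and $\pi_0$ for the inclusion $\mathbb C^n\subseteq E_0$. The bracket is the bilinear map given, for $\alpha,\beta\in q^{-1}(1)$, $\sigma,\tau\in\operatorname{rad}q$, $v,w\in\mathbb C^n$ and $\xi,\zeta\in(\operatorname{rad}_{\mathbb C}q)^*$, by $$[\pi_\sigma(v),\pi_\tau(w)]=\epsilon(\sigma,\tau)q(v,w)\pi_{\sigma+\tau}(\sigma),\qquad [\pi_\sigma(v),e_\beta]=-[e_\beta,\pi_\sigma(v)]=\epsilon(\sigma,\beta)q(v,\beta)e_{\beta+\sigma},$$ $$[e_\alpha,e_\beta]=\begin{cases}\epsilon(\alpha,\beta)e_{\alpha+\beta}&\text{if }q(\alpha+\beta)=1,\\ \epsilon(\alpha,\beta)\pi_{\alpha+\beta}(\alpha)&\text{if }q(\alpha+\beta)=0,\\ 0&\text{otherwise,}\end{cases}$$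 $$[\xi,e_\beta]=-[e_\beta,\xi]=\xi(\rho(\beta))e_\beta,\qquad [\xi,\pi_\tau(w)]=-[\pi_\tau(w),\xi]=\xi(\rho(\tau))\pi_\tau(w),\qquad [\xi,\zeta]=0.$$ The bilinear form $(-,-)$ on $E$ is given by $(e_\alpha,-e_{-\alpha})=1$, $(\pi_\sigma(v),\pi_{-\sigma}(w))=q(v,w)$, $(\xi,\pi_0(w))=(\pi_0(w),\xi)=\xi(\rho(w))$, and zero in all other cases. Then $E$ is a complex Lie algebra, and $(E,H,(-,-))$ with $H=E_0$ is an extended affine Lie algebra, that is: (1) $(-,-)$ is symmetric, non-degenerate and invariant; (2) $H$ is a non-zero finite dimensional abelian subalgebra equal to its own centralizer, and $\operatorname{ad}h$ is diagonalizable for all $h\in H$; (3) for every non-isotropic root $\alpha$ and every $x$ in the root space of $\alpha$, $\operatorname{ad}x$ is locally nilpotent (roots are the $\alpha\in H^*$ with non-zero root space, and the form is transferred to $H^*$ along the isomorphism $h\mapsto(h,-)$); (4) the set of roots is discrete in $H^*$; (5) the set of non-isotropic roots is not a disjoint union of two non-empty mutually orthogonal subsets. Its root system is $R(q)$: the additive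 map $\mathbb Z^n\to H^*$ which sends $\alpha$ to the functional $\pi_0(v)+\xi\mapsto q(v,\alpha)+\xi(\rho(\alpha))$ is injective, it takes $q(-,-)$ to the form transferred to $H^*$, it maps $R(q)$ onto the set of roots of $E$ with respect to $H$, and for $\alpha\in R(q)$ the root space of the image of $\alpha$ is $E_\alpha$. The nullity of $E$, i.e. the dimension of the real subspace of $H^*$ spanned by the isotropic roots, equals the corank of $q$. -/

import Mathlib

open scoped DirectSum

/-! ## Extended affine Lie algebras -/

namespace EALA

section

variable {L : Type*} [LieRing L] [LieAlgebra ℂ L]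
  (H : LieSubalgebra ℂ L) (form : LinearMap.BilinForm ℂ L)

/-- The root space `L_α = {x | [h, x] = α(h) x for all h ∈ H}` of `α ∈ H^*`. -/
def rootSpace (α : Module.Dual ℂ H) : Submodule ℂ L where
  carrier := {x | ∀ h : H, ⁅(h : L), x⁆ = α h • x}
  zero_mem' := by simp
  add_mem' := by
    intro x y hx hy h
    rw [lie_add, hx h, hy h, smul_add]
  smul_mem' := by
    intro c x hx h
    rw [lie_smul, hx h, smul_comm]

/-- The root system `R = {α ∈ H^* | L_α ≠ 0}` of `L` with respect to `H`. -/
def roots : Set (Module.Dual ℂ H) := {α | rootSpace H α ≠ ⊥}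

/-- The map `H → H^*`, `h ↦ (h, -)`. -/
def toDual : H →ₗ[ℂ] Module.Dual ℂ H := form.compl₁₂ H.toSubmodule.subtype H.toSubmodule.subtype

/-- The form transferred to `H^*` along `h ↦ (h, -)`: `(α, β) = (t_α, t_β)` where `t_α` denotes the
element of `H` with `(t_α, -) = α` (here `Function.invFun` is the inverse of `h ↦ (h, -)`, which is
bijective as soon as the axioms (EA1) and (EA2) below hold). -/
noncomputable def dualForm (α β : Module.Dual ℂ H) : ℂ :=
  form (Function.invFun (toDual H form) α : H) (Function.invFun (toDual H form) β : H)

/-- The set `R⁰` of isotropic roots. -/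
def isotropicRoots : Set (Module.Dual ℂ H) := {α ∈ roots H | dualForm H form α α = 0}

/-- The set `R^×` of non-isotropic roots. -/
def nonisotropicRoots : Set (Module.Dual ℂ H) := {α ∈ roots H | dualForm H form α α ≠ 0}

/-- The triple `(L, H, (-,-))` is an extended affine Lie algebra. -/
structure IsExtendedAffine : Prop where
  /-- (EA1) the form is symmetric, -/
  symm : form.IsSymm
  /-- (EA1) non-degenerate -/
  nondegenerate : form.Nondegenerate
  /-- (EA1) and invariant. -/
  invariant : ∀ x y z : L, form ⁅x, y⁆ z = form x ⁅y, z⁆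
  /-- (EA2) `H` is non-trivial, -/
  ne_bot : H ≠ ⊥
  /-- (EA2) finite dimensional, -/
  finite : FiniteDimensional ℂ H
  /-- (EA2) abelian, -/
  abelian : ∀ x ∈ H, ∀ y ∈ H, ⁅x, y⁆ = 0
  /-- (EA2) equal to its own centralizer -/
  centralizer : ∀ x : L, x ∈ H ↔ ∀ h ∈ H, ⁅h, x⁆ = 0
  /-- (EA2) and `ad h` is diagonalizable for all `h ∈ H`. -/
  diagonalizable : ∀ h ∈ H, ⨆ c : ℂ, (LieAlgebra.ad ℂ L h).eigenspace c = ⊤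
  /-- (EA3) `ad x` is locally nilpotent for every `x` in a non-isotropic root space. -/
  locallyNilpotent : ∀ α ∈ nonisotropicRoots H form, ∀ x ∈ rootSpace H α, ∀ y : L,
    ∃ m : ℕ, 0 < m ∧ (LieAlgebra.ad ℂ L x ^ m) y = 0
  /-- (EA4) `R` is a discrete subset of `H^*`, where `H^*` carries the usual topology of a
  finite dimensional complex vector space. -/
  discrete : @IsDiscrete (Module.Dual ℂ H) (moduleTopology ℂ (Module.Dual ℂ H)) (roots H)
  /-- (EA5) `R^×` is irreducible. -/
  irreducible : ¬ ∃ R₁ R₂ : Set (Module.Dual ℂ H), R₁.Nonempty ∧ R₂.Nonempty ∧ Disjoint R₁ R₂ ∧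
    R₁ ∪ R₂ = nonisotropicRoots H form ∧ ∀ α ∈ R₁, ∀ β ∈ R₂, dualForm H form α β = 0

/-- The nullity: the dimension of the real vector space spanned by the isotropic roots. -/
noncomputable def nullity : ℕ :=
  Module.finrank ℝ (Submodule.span ℝ (isotropicRoots H form))

end

/-- A bilinear map is a Lie bracket if it is alternating and satisfies the Jacobi identity. -/
structure IsLieBracket {L : Type*} [AddCommGroup L] [Module ℂ L] (b : L →ₗ[ℂ] L →ₗ[ℂ] L) :
    Prop where
  self : ∀ x, b x x = 0
  jacobi : ∀ x y z, b x (b y z) + b y (b z x) + b z (b x y) = 0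

namespace IsLieBracket

variable {L : Type*} [AddCommGroup L] [Module ℂ L] {b : L →ₗ[ℂ] L →ₗ[ℂ] L}

theorem swap (h : IsLieBracket b) (x y : L) : b x y = - b y x := by
  have := h.self (x + y)
  simp only [map_add, LinearMap.add_apply, h.self, zero_add, add_zero] at this
  rw [eq_neg_iff_add_eq_zero, add_comm, ← this]

/-- The Lie ring with bracket `b`. -/
abbrev lieRing (h : IsLieBracket b) : LieRing L :=
  { (inferInstance : AddCommGroup L) with
    bracket := fun x y => b x y
    add_lie := by intro x y z; simp
    lie_add := by intro x y z; simp
    lie_self := by intro x; exact h.self x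
    leibniz_lie := by
      intro x y z
      have := h.jacobi x y z
      rw [h.swap z (b x y), h.swap z x, map_neg] at this
      change b x (b y z) = b (b x y) z + b y (b x z)
      rw [← sub_eq_zero, ← this]
      abel }

/-- The complex Lie algebra with bracket `b`. -/
abbrev lieAlgebra (h : IsLieBracket b) : @LieAlgebra ℂ L _ h.lieRing :=
  letI := h.lieRing
  { (inferInstance : Module ℂ L) with
    lie_smul := by intro t x y; exact (b x).map_smul t y }

end IsLieBracket

end EALA

/-! ## Unit forms -/

namespace UnitForm

noncomputable section

variable {n : ℕ} (q : QuadraticForm ℤ (Fin n → ℤ))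

/-- `q` is a unit form: `q(x) = ∑ xᵢ² + ∑_{i<j} qᵢⱼ xᵢ xⱼ` with integers `qᵢⱼ`. -/
def IsUnitForm : Prop :=
  ∃ a : Fin n → Fin n → ℤ, ∀ x : Fin n → ℤ,
    q x = ∑ i, x i ^ 2 + ∑ i, ∑ j ∈ Finset.Ioi i, a i j * x i * x j

/-- `q` is non-negative. -/
def IsNonneg : Prop := ∀ x, 0 ≤ q x

/-- The symmetric integer matrix `C` with `Cᵢⱼ = q(cᵢ + cⱼ) - q(cᵢ) - q(cⱼ)`. -/
def gram : Matrix (Fin n) (Fin n) ℤ :=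
  fun i j => QuadraticMap.polar q (Pi.single i 1) (Pi.single j 1)

/-- The graph underlying the bigraph of `q`: for `i ≠ j` there is an edge between `i` and `j` if
`qᵢⱼ ≠ 0` (multiplicities and signs of the edges do not affect connectedness). -/
def graph : SimpleGraph (Fin n) where
  Adj i j := i ≠ j ∧ gram q i j ≠ 0
  symm := ⟨by
    rintro i j ⟨h, h'⟩
    refine ⟨h.symm, ?_⟩
    rwa [gram, QuadraticMap.polar_comm]⟩
  loopless := ⟨fun _ h => h.1 rfl⟩

/-- `q` is connected (in particular `n ≥ 1`). -/
def IsConnected : Prop := (graph q).Connected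

/-- The radical `rad q = {x ∈ ℤⁿ | q(x, -) = 0}`, where `q(x, y) = q(x + y) - q(x) - q(y)`. -/
def rad : Submodule ℤ (Fin n → ℤ) := LinearMap.ker q.polarBilin

/-- The corank of `q`, i.e. the rank of its radical. -/
def corank : ℕ := Module.finrank ℤ (rad q)

/-- The set `R(q) = q⁻¹(0) ∪ q⁻¹(1)` of roots of `q`. -/
def rootSet : Set (Fin n → ℤ) := q ⁻¹' {0} ∪ q ⁻¹' {1}

/-- The inclusion `ℤⁿ ⊆ ℂⁿ`. -/
def toC (x : Fin n → ℤ) : Fin n → ℂ := fun i => (x i : ℂ)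

/-- The complexified radical, as a subspace of `ℂⁿ`. -/
def radC : Submodule ℂ (Fin n → ℂ) := Submodule.span ℂ (toC '' (rad q : Set (Fin n → ℤ)))

/-- The bilinear form `q(v, w) = vᵀ C w` on `ℂⁿ`. -/
def bilC : LinearMap.BilinForm ℂ (Fin n → ℂ) :=
  Matrix.toBilin' ((gram q).map (Int.cast : ℤ → ℂ))

theorem toC_add (x y : Fin n → ℤ) : toC (x + y) = toC x + toC y := by
  ext i; simp [toC]

theorem toC_zero : toC (0 : Fin n → ℤ) = 0 := by
  ext i; simp [toC]

theorem bilC_toC (x y : Fin n → ℤ) : bilC q (toC x) (toC y) = ((QuadraticMap.polar q x y : ℤ) : ℂ) := by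
  have h : q.polarBilin x y = ∑ i, ∑ j, x i * gram q i j * y j := by
    conv_lhs => rw [← Finset.univ_sum_single x, ← Finset.univ_sum_single y]
    simp only [map_sum, LinearMap.sum_apply]
    rw [Finset.sum_comm]
    refine Finset.sum_congr rfl fun i _ => Finset.sum_congr rfl fun j _ => ?_
    have e : ∀ (k : Fin n) (z : ℤ), (Pi.single k z : Fin n → ℤ) = z • Pi.single k 1 := by
      intro k z; rw [← Pi.single_smul]; simp
    rw [e i, e j, map_smul, map_smul, LinearMap.smul_apply]
    simp only [smul_eq_mul, gram, QuadraticMap.polarBilin_apply_apply]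
    ring
  rw [QuadraticMap.polarBilin_apply_apply] at h
  rw [h, bilC, Matrix.toBilin'_apply]
  push_cast
  rfl

theorem bilC_comm (v w : Fin n → ℂ) : bilC q v w = bilC q w v := by
  simp only [bilC, Matrix.toBilin'_apply, Matrix.map_apply]
  rw [Finset.sum_comm]
  refine Finset.sum_congr rfl fun i _ => Finset.sum_congr rfl fun j _ => ?_
  have : gram q j i = gram q i j := QuadraticMap.polar_comm _ _ _
  rw [this]; ring

theorem toC_single (i : Fin n) : toC (Pi.single i 1) = (Pi.single i 1 : Fin n → ℂ) := by
  ext j; by_cases h : j = i <;> simp [toC, h]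

theorem radC_le_ker : radC q ≤ LinearMap.ker (bilC q) := by
  refine Submodule.span_le.2 ?_
  rintro _ ⟨x, hx, rfl⟩
  refine (LinearMap.mem_ker).2 ?_
  refine LinearMap.pi_ext' fun i => LinearMap.ext_ring ?_
  have h : q.polarBilin x (Pi.single i 1) = 0 := by
    rw [LinearMap.mem_ker.1 hx]; rfl
  simpa [toC_single, QuadraticMap.polarBilin_apply_apply] using
    (bilC_toC q x (Pi.single i 1)).trans (by exact_mod_cast h)

theorem radC_le_ker_flip : radC q ≤ LinearMap.ker (bilC q).flip := by
  intro v hv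
  have h := radC_le_ker q hv
  rw [LinearMap.mem_ker] at h ⊢
  ext w
  simpa [bilC_comm q _ v] using LinearMap.congr_fun h (Pi.single w 1)

/-! ## The algebras `N(q)` and `E(q)`

Both have the form `⨁_{α ∈ q⁻¹(1)} ℂ e_α ⊕ ⨁_{σ ∈ rad q} ℂⁿ/W_σ ⊕ (rad_ℂ q)^*` with `W_0 = 0`
and `W_σ ⊆ rad_ℂ q`, and the same bracket rules. -/

/-- A family of subspaces `W_σ` of `rad_ℂ q`, for `σ ∈ rad q`, with `W_0 = 0`. -/
structure RadFamily where
  W : rad q → Submodule ℂ (Fin n → ℂ)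
  le : ∀ σ, W σ ≤ radC q
  zero : W 0 = ⊥

/-- `W_σ = ℂ σ`. -/
def famN : RadFamily q where
  W σ := Submodule.span ℂ {toC (σ : Fin n → ℤ)}
  le σ := Submodule.span_le.2 (by
    rintro _ rfl
    exact Submodule.subset_span ⟨_, σ.2, rfl⟩)
  zero := by simp [toC_zero]

/-- `W_σ = rad_ℂ q` for `σ ≠ 0`, and `W_0 = 0`. -/
def famE : RadFamily q where
  W σ := if σ = 0 then ⊥ else radC q
  le σ := by split_ifs <;> simp
  zero := by simp

variable {q}

/-- The vector space `⨁_{α ∈ q⁻¹(1)} ℂ e_α ⊕ ⨁_{σ ∈ rad q} ℂⁿ/W_σ ⊕ (rad_ℂ q)^*`. -/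
def Alg (F : RadFamily q) : Type :=
  ({α : Fin n → ℤ // q α = 1} →₀ ℂ) × (⨁ σ : rad q, ((Fin n → ℂ) ⧸ F.W σ)) ×
    Module.Dual ℂ (radC q)

variable (F : RadFamily q)

instance : AddCommGroup (Alg F) :=
  inferInstanceAs (AddCommGroup (({α : Fin n → ℤ // q α = 1} →₀ ℂ) ×
    (⨁ σ : rad q, ((Fin n → ℂ) ⧸ F.W σ)) × Module.Dual ℂ (radC q)))

instance : Module ℂ (Alg F) :=
  inferInstanceAs (Module ℂ (({α : Fin n → ℤ // q α = 1} →₀ ℂ) ×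
    (⨁ σ : rad q, ((Fin n → ℂ) ⧸ F.W σ)) × Module.Dual ℂ (radC q)))

/-- The inclusion of the first block. -/
def inE : ({α : Fin n → ℤ // q α = 1} →₀ ℂ) →ₗ[ℂ] Alg F where
  toFun x := (x, 0, 0)
  map_add' x y := by refine Prod.ext rfl (Prod.ext ?_ ?_) <;> exact (add_zero _).symm
  map_smul' c x := by refine Prod.ext rfl (Prod.ext ?_ ?_) <;> exact (smul_zero _).symm

/-- The inclusion of the second block. -/
def inP : (⨁ σ : rad q, ((Fin n → ℂ) ⧸ F.W σ)) →ₗ[ℂ] Alg F where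
  toFun x := (0, x, 0)
  map_add' x y := by refine Prod.ext ?_ (Prod.ext rfl ?_) <;> exact (add_zero _).symm
  map_smul' c x := by refine Prod.ext ?_ (Prod.ext rfl ?_) <;> exact (smul_zero _).symm

/-- The inclusion of the third block `(rad_ℂ q)^*`. -/
def inDual : Module.Dual ℂ (radC q) →ₗ[ℂ] Alg F where
  toFun x := (0, 0, x)
  map_add' x y := by refine Prod.ext ?_ (Prod.ext ?_ rfl) <;> exact (add_zero _).symm
  map_smul' c x := by refine Prod.ext ?_ (Prod.ext ?_ rfl) <;> exact (smul_zero _).symm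

/-- The projection onto the first block. -/
def fstE : Alg F →ₗ[ℂ] ({α : Fin n → ℤ // q α = 1} →₀ ℂ) where
  toFun x := x.1
  map_add' _ _ := rfl
  map_smul' _ _ := rfl

/-- The projection onto the second block. -/
def sndP : Alg F →ₗ[ℂ] (⨁ σ : rad q, ((Fin n → ℂ) ⧸ F.W σ)) where
  toFun x := x.2.1
  map_add' _ _ := rfl
  map_smul' _ _ := rfl

/-- The projection onto the third block. -/
def trdX : Alg F →ₗ[ℂ] Module.Dual ℂ (radC q) where
  toFun x := x.2.2
  map_add' _ _ := rfl
  map_smul' _ _ := rfl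

/-- The basis vector `e_α` for `α ∈ q⁻¹(1)`; by convention `e_α = 0` for all other `α`. -/
def e (α : Fin n → ℤ) : Alg F :=
  if h : q α = 1 then inE F (Finsupp.single ⟨α, h⟩ 1) else 0

open Classical in
/-- The canonical projection `π_σ` from `ℂⁿ` onto the summand `ℂⁿ/W_σ` for `σ ∈ rad q`; by
convention `π_σ = 0` for all other `σ`. -/
def proj (σ : Fin n → ℤ) : (Fin n → ℂ) →ₗ[ℂ] Alg F :=
  if h : σ ∈ rad q then
    inP F ∘ₗ
      DirectSum.lof ℂ (rad q) (fun σ => (Fin n → ℂ) ⧸ F.W σ) ⟨σ, h⟩ ∘ₗ (F.W ⟨σ, h⟩).mkQ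
  else 0

/-- The form `q(v, β)` of a class `v ∈ ℂⁿ/W_σ` with `β ∈ ℂⁿ`. -/
def pairL (σ : rad q) (β : Fin n → ℂ) : ((Fin n → ℂ) ⧸ F.W σ) →ₗ[ℂ] ℂ :=
  (F.W σ).liftQ ((bilC q).flip β) fun v hv => by
    have := radC_le_ker q (F.le σ hv)
    rw [LinearMap.mem_ker] at this ⊢
    simp [this]

/-- The form `q(v, w)` of classes `v ∈ ℂⁿ/W_σ` and `w ∈ ℂⁿ/W_τ`. -/
def pair (σ τ : rad q) : ((Fin n → ℂ) ⧸ F.W σ) →ₗ[ℂ] ((Fin n → ℂ) ⧸ F.W τ) →ₗ[ℂ] ℂ :=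
  LinearMap.liftQ₂ (F.W σ) (F.W τ) (bilC q) ((F.le σ).trans (radC_le_ker q))
    ((F.le τ).trans (radC_le_ker_flip q))

variable (B : LinearMap.BilinForm ℤ (Fin n → ℤ)) (ρ : (Fin n → ℂ) →ₗ[ℂ] radC q)

/-- The sign `ε(α, β) = (-1)^{B(α, β)}`. -/
def eps (α β : Fin n → ℤ) : ℂ := (-1 : ℂ) ^ (B α β)

/-- `[e_α, e_β] = ε(α, β) e_{α+β}` if `q(α + β) = 1`, `[e_α, e_β] = ε(α, β) π_{α+β}(α)` if
`α + β ∈ rad q`, and `0` otherwise. -/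
def brEE : ({α : Fin n → ℤ // q α = 1} →₀ ℂ) →ₗ[ℂ] ({α : Fin n → ℤ // q α = 1} →₀ ℂ) →ₗ[ℂ]
    Alg F :=
  Finsupp.linearCombination ℂ fun α => Finsupp.linearCombination ℂ fun β =>
    eps B α β • (e F (α + β : Fin n → ℤ) + proj F (α + β : Fin n → ℤ) (toC α))

/-- `[π_σ(v), e_β] = ε(σ, β) q(v, β) e_{β+σ}`. -/
def brPE : (⨁ σ : rad q, ((Fin n → ℂ) ⧸ F.W σ)) →ₗ[ℂ] ({α : Fin n → ℤ // q α = 1} →₀ ℂ) →ₗ[ℂ]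
    Alg F :=
  LinearMap.flip <| Finsupp.linearCombination ℂ fun β => DirectSum.toModule ℂ _ _ fun σ =>
    (pairL F σ (toC β)).smulRight (eps B σ β • e F (β + σ : Fin n → ℤ))

/-- `[π_σ(v), π_τ(w)] = ε(σ, τ) q(v, w) π_{σ+τ}(σ)`. -/
def brPP : (⨁ σ : rad q, ((Fin n → ℂ) ⧸ F.W σ)) →ₗ[ℂ] (⨁ σ : rad q, ((Fin n → ℂ) ⧸ F.W σ)) →ₗ[ℂ]
    Alg F :=
  DirectSum.toModule ℂ _ _ fun σ => LinearMap.flip <| DirectSum.toModule ℂ _ _ fun τ =>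
    LinearMap.flip <| (pair F σ τ).compr₂
      (LinearMap.toSpanSingleton ℂ (Alg F)
        (eps B σ τ • proj F (σ + τ : Fin n → ℤ) (toC (σ : Fin n → ℤ))))

/-- `[ξ, e_β] = ξ(ρ(β)) e_β`. -/
def brXE : Module.Dual ℂ (radC q) →ₗ[ℂ] ({α : Fin n → ℤ // q α = 1} →₀ ℂ) →ₗ[ℂ] Alg F :=
  LinearMap.flip <| Finsupp.linearCombination ℂ fun β =>
    (Module.Dual.eval ℂ (radC q) (ρ (toC β))).smulRight (e F β)

/-- `[ξ, π_τ(w)] = ξ(ρ(τ)) π_τ(w)`. -/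
def brXP : Module.Dual ℂ (radC q) →ₗ[ℂ] (⨁ σ : rad q, ((Fin n → ℂ) ⧸ F.W σ)) →ₗ[ℂ] Alg F :=
  LinearMap.flip <| DirectSum.toModule ℂ _ _ fun τ => LinearMap.flip <|
    (Module.Dual.eval ℂ (radC q) (ρ (toC (τ : Fin n → ℤ)))).smulRight
      (inP F ∘ₗ
        DirectSum.lof ℂ (rad q) (fun σ => (Fin n → ℂ) ⧸ F.W σ) τ)

/-- The bracket. -/
def bracket : Alg F →ₗ[ℂ] Alg F →ₗ[ℂ] Alg F :=
  (brEE F B).compl₁₂ (fstE F) (fstE F)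
    + ((brPE F B).compl₁₂ (sndP F) (fstE F) - ((brPE F B).compl₁₂ (sndP F) (fstE F)).flip)
    + (brPP F B).compl₁₂ (sndP F) (sndP F)
    + ((brXE F ρ).compl₁₂ (trdX F) (fstE F) - ((brXE F ρ).compl₁₂ (trdX F) (fstE F)).flip)
    + ((brXP F ρ).compl₁₂ (trdX F) (sndP F) - ((brXP F ρ).compl₁₂ (trdX F) (sndP F)).flip)

/-- The blocks of the form: `(e_α, e_{-α}) = -1`. -/
def foEE : ({α : Fin n → ℤ // q α = 1} →₀ ℂ) →ₗ[ℂ] ({α : Fin n → ℤ // q α = 1} →₀ ℂ) →ₗ[ℂ] ℂ :=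
  Finsupp.linearCombination ℂ fun α => Finsupp.linearCombination ℂ fun β =>
    if (α + β : Fin n → ℤ) = 0 then -1 else 0

/-- `(π_σ(v), π_{-σ}(w)) = q(v, w)`. -/
def foPP : (⨁ σ : rad q, ((Fin n → ℂ) ⧸ F.W σ)) →ₗ[ℂ] (⨁ σ : rad q, ((Fin n → ℂ) ⧸ F.W σ)) →ₗ[ℂ]
    ℂ :=
  DirectSum.toModule ℂ _ _ fun σ => LinearMap.flip <| DirectSum.toModule ℂ _ _ fun τ =>
    LinearMap.flip <| if σ + τ = 0 then pair F σ τ else 0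

/-- `(ξ, π_0(w)) = ξ(ρ(w))`. -/
def foXP : Module.Dual ℂ (radC q) →ₗ[ℂ] (⨁ σ : rad q, ((Fin n → ℂ) ⧸ F.W σ)) →ₗ[ℂ] ℂ :=
  LinearMap.flip <| DirectSum.toModule ℂ _ _ fun τ =>
    (F.W τ).liftQ (if τ = 0 then Module.Dual.eval ℂ (radC q) ∘ₗ ρ else 0) (by
      split_ifs with h
      · subst h; rw [F.zero]; exact bot_le
      · simp)

/-- The bilinear form. -/
def form : LinearMap.BilinForm ℂ (Alg F) :=
  foEE.compl₁₂ (fstE F) (fstE F) + (foPP F).compl₁₂ (sndP F) (sndP F)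
    + ((foXP F ρ).compl₁₂ (trdX F) (sndP F) + ((foXP F ρ).compl₁₂ (trdX F) (sndP F)).flip)

/-- The homogeneous component of degree `α`: it is `ℂ e_α` if `q(α) = 1`, `ℂⁿ/W_α` if
`0 ≠ α ∈ rad q`, and `ℂⁿ ⊕ (rad_ℂ q)^*` if `α = 0`. -/
def component (α : Fin n → ℤ) : Submodule ℂ (Alg F) :=
  if α = 0 then LinearMap.range (proj F 0) ⊔ LinearMap.range (inDual F)
  else if q α = 1 then Submodule.span ℂ {e F α}
  else LinearMap.range (proj F α)

/-- The linear functional which on `ℂⁿ ⊕ (rad_ℂ q)^*` is `π_0(v) + ξ ↦ q(v, α) + ξ(ρ(α))` and which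
vanishes on the components of non-zero degree. -/
def weight (α : Fin n → ℤ) : Module.Dual ℂ (Alg F) :=
  pairL F 0 (toC α) ∘ₗ
      DirectSum.component ℂ (rad q) (fun σ => (Fin n → ℂ) ⧸ F.W σ) 0 ∘ₗ sndP F
    + Module.Dual.eval ℂ (radC q) (ρ (toC α)) ∘ₗ trdX F

variable (q) in
/-- The algebra `N(q)`, with bracket `bracket (famN q) B ρ`. -/
abbrev N : Type := Alg (famN q)

variable (q) in
/-- The algebra `E(q)`, with bracket `bracket (famE q) B ρ`; it is the factor of `N(q)` along the
canonical projections `ℂⁿ/ℂσ → ℂⁿ/rad_ℂ q` for `0 ≠ σ ∈ rad q`. -/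
abbrev E : Type := Alg (famE q)

/-! The bracket rules on generators, and `E(q)` as a factor of `N(q)`. -/

@[simp] theorem fstE_inE (x) : fstE F (inE F x) = x := rfl
@[simp] theorem fstE_inP (x) : fstE F (inP F x) = 0 := rfl
@[simp] theorem fstE_inDual (x) : fstE F (inDual F x) = 0 := rfl
@[simp] theorem sndP_inE (x) : sndP F (inE F x) = 0 := rfl
@[simp] theorem sndP_inP (x) : sndP F (inP F x) = x := rfl
@[simp] theorem sndP_inDual (x) : sndP F (inDual F x) = 0 := rfl
@[simp] theorem trdX_inE (x) : trdX F (inE F x) = 0 := rfl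
@[simp] theorem trdX_inP (x) : trdX F (inP F x) = 0 := rfl
@[simp] theorem trdX_inDual (x) : trdX F (inDual F x) = x := rfl

theorem e_of {α : Fin n → ℤ} (h : q α = 1) : e F α = inE F (Finsupp.single ⟨α, h⟩ 1) := dif_pos h
theorem e_ne {α : Fin n → ℤ} (h : q α ≠ 1) : e F α = 0 := dif_neg h
theorem proj_of {σ : Fin n → ℤ} (h : σ ∈ rad q) (v : Fin n → ℂ) :
    proj F σ v = inP F (DirectSum.lof ℂ (rad q) (fun σ => (Fin n → ℂ) ⧸ F.W σ) ⟨σ, h⟩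
      (Submodule.Quotient.mk v)) := by
  simp [proj, h]
theorem proj_ne {σ : Fin n → ℤ} (h : σ ∉ rad q) (v : Fin n → ℂ) : proj F σ v = 0 := by
  simp [proj, h]

@[simp] theorem pairL_mk (σ : rad q) (β v) : pairL F σ β (Submodule.Quotient.mk v) = bilC q v β := rfl
@[simp] theorem pair_mk (σ τ : rad q) (v w) :
  pair F σ τ (Submodule.Quotient.mk v) (Submodule.Quotient.mk w) = bilC q v w := rfl

theorem bracket_proj_proj {σ τ : Fin n → ℤ} (hσ : σ ∈ rad q) (hτ : τ ∈ rad q) (v w) :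
    bracket F B ρ (proj F σ v) (proj F τ w) =
      (eps B σ τ * bilC q v w) • proj F (σ + τ) (toC σ) := by
  simp [proj_of F hσ, proj_of F hτ, bracket, brPP, brEE, smul_smul, mul_comm]
theorem bracket_proj_e {σ β : Fin n → ℤ} (hσ : σ ∈ rad q) (hβ : q β = 1) (v) :
    bracket F B ρ (proj F σ v) (e F β) = (eps B σ β * bilC q v (toC β)) • e F (β + σ) := by
  simp [proj_of F hσ, e_of F hβ, bracket, brPE, smul_smul, mul_comm]
theorem bracket_e_proj {σ β : Fin n → ℤ} (hσ : σ ∈ rad q) (hβ : q β = 1) (v) :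
    bracket F B ρ (e F β) (proj F σ v) = -((eps B σ β * bilC q v (toC β)) • e F (β + σ)) := by
  simp [proj_of F hσ, e_of F hβ, bracket, brPE, smul_smul, mul_comm]
theorem bracket_e_e {α β : Fin n → ℤ} (hα : q α = 1) (hβ : q β = 1) :
    bracket F B ρ (e F α) (e F β) = eps B α β • (e F (α + β) + proj F (α + β) (toC α)) := by
  simp [e_of F hα, e_of F hβ, bracket, brEE]
theorem bracket_inDual_e {β : Fin n → ℤ} (hβ : q β = 1) (ξ) :
    bracket F B ρ (inDual F ξ) (e F β) = ξ (ρ (toC β)) • e F β := by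
  simp [e_of F hβ, bracket, brXE]
theorem bracket_e_inDual {β : Fin n → ℤ} (hβ : q β = 1) (ξ) :
    bracket F B ρ (e F β) (inDual F ξ) = -(ξ (ρ (toC β)) • e F β) := by
  simp [e_of F hβ, bracket, brXE]
theorem bracket_inDual_proj {τ : Fin n → ℤ} (hτ : τ ∈ rad q) (w ξ) :
    bracket F B ρ (inDual F ξ) (proj F τ w) = ξ (ρ (toC τ)) • proj F τ w := by
  simp [proj_of F hτ, bracket, brXP]
theorem bracket_proj_inDual {τ : Fin n → ℤ} (hτ : τ ∈ rad q) (w ξ) :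
    bracket F B ρ (proj F τ w) (inDual F ξ) = -(ξ (ρ (toC τ)) • proj F τ w) := by
  simp [proj_of F hτ, bracket, brXP]
theorem bracket_inDual_inDual (ξ ζ) : bracket F B ρ (inDual F ξ) (inDual F ζ) = 0 := by
  simp [bracket]

/-- The canonical map `N(q) → E(q)`: it is the identity on `ℂ e_α` and on `(rad_ℂ q)^*`, and the
canonical projection `ℂⁿ/W_σ → ℂⁿ/W'_σ` on the component of degree `σ ∈ rad q`. -/
def canon : N q →ₗ[ℂ] E q :=
  inE (famE q) ∘ₗ fstE (famN q) + inDual (famE q) ∘ₗ trdX (famN q) +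
    (DirectSum.toModule ℂ _ _ fun σ =>
      ((famN q).W σ).liftQ (proj (famE q) (σ : Fin n → ℤ)) (by
        intro v hv
        rw [LinearMap.mem_ker, proj_of _ σ.2]
        have : v ∈ (famE q).W σ := by
          by_cases h : σ = 0
          · subst h; rw [(famN q).zero] at hv; rw [(famE q).zero]; exact hv
          · simpa [famE, h] using (famN q).le σ hv
        rw [(Submodule.Quotient.mk_eq_zero _).2 this]; simp)) ∘ₗ sndP (famN q)

theorem canon_e (α : Fin n → ℤ) : canon (e (famN q) α) = e (famE q) α := by
  by_cases h : q α = 1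
  · simp [e_of _ h, canon]
  · simp [e_ne _ h]

theorem canon_proj (σ : Fin n → ℤ) (v : Fin n → ℂ) :
    canon (proj (famN q) σ v) = proj (famE q) σ v := by
  by_cases h : σ ∈ rad q
  · rw [proj_of _ h]
    simp [canon]
  · simp [proj_ne _ h]

theorem canon_inDual (ξ : Module.Dual ℂ (radC q)) :
    canon (inDual (famN q) ξ) = inDual (famE q) ξ := by
  simp [canon]

/-- A linear map out of the algebra is determined by its values on the `e_α`, `π_σ(v)` and `ξ`. -/
theorem alg_hom_ext {M : Type*} [AddCommGroup M] [Module ℂ M] {f g : Alg F →ₗ[ℂ] M}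
    (he : ∀ α, q α = 1 → f (e F α) = g (e F α))
    (hp : ∀ σ ∈ rad q, ∀ v, f (proj F σ v) = g (proj F σ v))
    (hx : ∀ ξ, f (inDual F ξ) = g (inDual F ξ)) : f = g := by
  have h1 : f ∘ₗ inE F = g ∘ₗ inE F := by
    refine Finsupp.lhom_ext' fun α => LinearMap.ext_ring ?_
    have := he α.1 α.2
    rw [e_of F α.2] at this
    exact this
  have h2 : f ∘ₗ inP F = g ∘ₗ inP F := by
    refine DirectSum.linearMap_ext ℂ fun σ => Submodule.linearMap_qext _ (LinearMap.ext fun v => ?_)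
    have := hp σ.1 σ.2 v
    rw [proj_of F σ.2] at this
    exact this
  ext x
  have hx' : x = inE F (fstE F x) + inP F (sndP F x) + inDual F (trdX F x) := by
    refine Prod.ext ?_ (Prod.ext ?_ ?_)
    · exact ((add_zero _).trans (add_zero _)).symm
    · exact ((add_zero _).trans (zero_add _)).symm
    · exact ((congrArg (· + _) (add_zero _)).trans (zero_add _)).symm
  rw [hx', map_add, map_add, map_add, map_add, hx]
  congr 2
  · exact LinearMap.congr_fun h1 _
  · exact LinearMap.congr_fun h2 _

/-- The bracket of `E(q)` is induced by the bracket of `N(q)`. -/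
theorem canon_bracket (x y : N q) :
    canon (bracket (famN q) B ρ x y) = bracket (famE q) B ρ (canon x) (canon y) := by
  have : (bracket (famN q) B ρ).compr₂ canon = (bracket (famE q) B ρ).compl₁₂ canon canon := by
    refine alg_hom_ext _ (fun α hα => alg_hom_ext _ (fun β hβ => ?_) (fun τ hτ w => ?_) fun ζ => ?_)
      (fun σ hσ v => alg_hom_ext _ (fun β hβ => ?_) (fun τ hτ w => ?_) fun ζ => ?_)
      (fun ξ => alg_hom_ext _ (fun β hβ => ?_) (fun τ hτ w => ?_) fun ζ => ?_) <;>
    simp [canon_e, canon_proj, canon_inDual, bracket_e_e, bracket_e_proj, bracket_proj_e,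
      bracket_proj_proj, bracket_e_inDual, bracket_inDual_e, bracket_proj_inDual,
      bracket_inDual_proj, bracket_inDual_inDual, *]
  exact LinearMap.congr_fun (LinearMap.congr_fun this x) y

theorem canon_surjective : Function.Surjective (canon : N q → E q) := by
  rw [← LinearMap.range_eq_top]
  suffices h : (LinearMap.range (canon : N q →ₗ[ℂ] E q)).mkQ = 0 by
    rw [← Submodule.ker_mkQ (LinearMap.range (canon : N q →ₗ[ℂ] E q)), h, LinearMap.ker_zero]
  refine alg_hom_ext _ (fun α _ => ?_) (fun σ _ v => ?_) fun ξ => ?_ <;>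
    simp only [LinearMap.zero_apply, Submodule.mkQ_apply, Submodule.Quotient.mk_eq_zero]
  · exact ⟨_, canon_e α⟩
  · exact ⟨_, canon_proj σ v⟩
  · exact ⟨_, canon_inDual ξ⟩

end

end UnitForm

/-!
The algebra `E(q)` is graded by `ℤⁿ`, with support the root set `R(q) = q⁻¹(0) ∪ q⁻¹(1)`, and nearly
everything is checked on the homogeneous generators `e_α`, `π_σ(v)` and `ξ`.

*Lie algebra and form.* The sign `ε` is bimultiplicative with `ε(β, α) = (-1)^{q(α, β)} ε(α, β)`, and
is symmetric when one argument lies in `rad q`. For a non-negative form `rad q = q⁻¹(0)`, and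
`-2 ≤ q(α, β) ≤ 2` for `α, β ∈ q⁻¹(1)`; so the Jacobi identity for `e_α, e_β, e_γ` is a finite case
distinction on the three mutual values (`jacobi_e_e_e`), in which the extreme value `-2` forces
`α + β ∈ rad q`. Terms in a quotient `ℂⁿ/W_σ` cancel because `σ ∈ W_σ`. The Jacobi identity, and the
cyclic invariance of `([x, y], z)`, are invariant under permutations of the three arguments, which
leaves ten types of triples (`alg_induction_triple`).

*Non-degeneracy.* The kernel of `q(-, -)` on `ℂⁿ` is the complex span of the integral radical
(`mem_radC_of_bilC`), because the Gram matrix is rational.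

*Roots.* The weight of `α` is represented by `π_0(α)` under the form (`weight_eq_form`). Hence the
weights are the values at integral vectors of a linear map from `ℂⁿ` to the dual of `E_0`
(`weightC`), and this map is injective since `ρ` is the identity on `rad_ℂ q`. Injectivity shows that
the homogeneous components are the full root spaces (`mem_component_iff`), so that `E_0` is its own
centralizer, that the roots form a discrete set, and that isotropic roots span a real space of
dimension the corank of `q`; and it gives `(α, β) = q(α, β)` for the transferred form. Moreover
`(ad e_α)³ = 0`, as `q(β + 3α) > 1` for every root `β`, and the connectedness of the graph of `q` gives
the irreducibility of the non-isotropic roots.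
-/

namespace UnitForm

noncomputable section

variable {n : ℕ} {q : QuadraticForm ℤ (Fin n → ℤ)}

section

/-! ### Non-negative integral quadratic forms -/

theorem map_add_eq (x y : Fin n → ℤ) : q (x + y) = q x + q y + QuadraticMap.polar q x y := by
  simp [QuadraticMap.polar]

theorem polar_self_eq (x : Fin n → ℤ) : QuadraticMap.polar q x x = 2 * q x := by
  simp [QuadraticMap.polar_self]

theorem polar_of_mem_rad {σ : Fin n → ℤ} (hσ : σ ∈ rad q) (x : Fin n → ℤ) :
    QuadraticMap.polar q σ x = 0 := by
  have := LinearMap.congr_fun (LinearMap.mem_ker.1 hσ) x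
  simpa using this

theorem polar_of_mem_rad_right {σ : Fin n → ℤ} (hσ : σ ∈ rad q) (x : Fin n → ℤ) :
    QuadraticMap.polar q x σ = 0 := by
  rw [QuadraticMap.polar_comm, polar_of_mem_rad hσ]

theorem map_of_mem_rad {σ : Fin n → ℤ} (hσ : σ ∈ rad q) : q σ = 0 := by
  have := polar_self_eq (q := q) σ
  rw [polar_of_mem_rad hσ] at this
  omega

theorem map_add_of_mem_rad {σ : Fin n → ℤ} (hσ : σ ∈ rad q) (x : Fin n → ℤ) :
    q (x + σ) = q x := by
  rw [map_add_eq, map_of_mem_rad hσ, polar_of_mem_rad_right hσ]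
  ring

theorem not_mem_rad_of_map_ne {x : Fin n → ℤ} (hx : q x ≠ 0) : x ∉ rad q :=
  fun h => hx (map_of_mem_rad h)

/-- For a non-negative form `rad q = q⁻¹(0)`: if `q(x) = 0`, then
`q(y + m x) = q(y) + m q(x, y)` is non-negative for all integers `m`. -/
theorem mem_rad_iff (hq : IsNonneg q) {x : Fin n → ℤ} : x ∈ rad q ↔ q x = 0 := by
  refine ⟨map_of_mem_rad, fun hx => ?_⟩
  rw [rad, LinearMap.mem_ker]
  refine LinearMap.ext fun y => ?_
  have key : ∀ m : ℤ, 0 ≤ q y + m * QuadraticMap.polar q x y := by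
    intro m
    have h := hq (y + m • x)
    rw [map_add_eq, QuadraticMap.map_smul, hx, QuadraticMap.polar_smul_right,
      QuadraticMap.polar_comm] at h
    simpa using h
  rw [QuadraticMap.polarBilin_apply_apply, LinearMap.zero_apply]
  have hy := hq y
  by_contra h
  -- the multiplier `m = -(q(y) + 1) q(x, y)` makes the value negative
  have := key (-(q y + 1) * QuadraticMap.polar q x y)
  have h2 : 0 < QuadraticMap.polar q x y * QuadraticMap.polar q x y := mul_self_pos.2 h
  nlinarith

theorem neg_two_le_polar (hq : IsNonneg q) {α β : Fin n → ℤ} (hα : q α = 1) (hβ : q β = 1) :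
    -2 ≤ QuadraticMap.polar q α β := by
  have := hq (α + β)
  rw [map_add_eq] at this
  omega

theorem polar_le_two (hq : IsNonneg q) {α β : Fin n → ℤ} (hα : q α = 1) (hβ : q β = 1) :
    QuadraticMap.polar q α β ≤ 2 := by
  have := hq (α + -β)
  rw [map_add_eq, QuadraticMap.map_neg, QuadraticMap.polar_neg_right] at this
  omega

theorem map_single (hq : IsUnitForm q) (i : Fin n) : q (Pi.single i 1) = 1 := by
  obtain ⟨a, ha⟩ := hq
  rw [ha, Finset.sum_eq_single i, Finset.sum_eq_zero]
  · simp
  · intro k _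
    refine Finset.sum_eq_zero fun l hl => ?_
    have hkl : k ≠ l := (Finset.mem_Ioi.1 hl).ne
    by_cases hk : k = i
    · have hl' : l ≠ i := fun h => hkl (hk.trans h.symm)
      simp [hl']
    · simp [hk]
  · intro j _ hj
    simp [hj]
  · simp

theorem mem_rad_of_polar_single {x : Fin n → ℤ}
    (hx : ∀ i, QuadraticMap.polar q x (Pi.single i 1) = 0) : x ∈ rad q := by
  rw [rad, LinearMap.mem_ker]
  refine LinearMap.pi_ext' fun i => LinearMap.ext_ring ?_
  simpa using hx i

/-! ### The sign cocycle -/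

variable {B : LinearMap.BilinForm ℤ (Fin n → ℤ)}

theorem eps_add_left (α β γ : Fin n → ℤ) : eps B (α + β) γ = eps B α γ * eps B β γ := by
  simp [eps, zpow_add₀]

theorem eps_add_right (α β γ : Fin n → ℤ) : eps B α (β + γ) = eps B α β * eps B α γ := by
  simp [eps, zpow_add₀]

@[simp] theorem eps_zero_left (α : Fin n → ℤ) : eps B 0 α = 1 := by simp [eps]

@[simp] theorem eps_zero_right (α : Fin n → ℤ) : eps B α 0 = 1 := by simp [eps]

theorem eps_mul_self (α β : Fin n → ℤ) : eps B α β * eps B α β = 1 := by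
  simp [eps, ← mul_zpow]

theorem eps_neg_right (α β : Fin n → ℤ) : eps B α (-β) = eps B α β := by
  have h1 := eps_add_right (B := B) α β (-β)
  rw [add_neg_cancel, eps_zero_right] at h1
  have h2 := eps_mul_self (B := B) α β
  have h3 : eps B α β ≠ 0 := fun h => by simp [h] at h2
  exact mul_left_cancel₀ h3 (h1.symm.trans h2.symm)

theorem add_flip_eq_polar (hB : ∀ x, B x x = q x) (α β : Fin n → ℤ) :
    B α β + B β α = QuadraticMap.polar q α β := by
  have := hB (α + β)
  simp only [map_add, LinearMap.add_apply, hB] at this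
  rw [QuadraticMap.polar, ← this]
  ring

theorem eps_swap (hB : ∀ x, B x x = q x) (α β : Fin n → ℤ) :
    eps B β α = (-1 : ℂ) ^ QuadraticMap.polar q α β * eps B α β := by
  rw [← add_flip_eq_polar hB, zpow_add₀ (by norm_num), mul_right_comm]
  change _ = eps B α β * eps B α β * eps B β α
  rw [eps_mul_self, one_mul]

theorem eps_rad_comm (hB : ∀ x, B x x = q x) {σ : Fin n → ℤ} (hσ : σ ∈ rad q) (β : Fin n → ℤ) :
    eps B β σ = eps B σ β := by
  rw [eps_swap hB σ β, polar_of_mem_rad hσ, zpow_zero, one_mul]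

end

section

/-! ### The complexified radical -/

theorem toC_mem_radC {σ : Fin n → ℤ} (hσ : σ ∈ rad q) : toC σ ∈ radC q :=
  Submodule.subset_span ⟨σ, hσ, rfl⟩

theorem bilC_of_mem_radC_left {v : Fin n → ℂ} (hv : v ∈ radC q) (w : Fin n → ℂ) :
    bilC q v w = 0 := by
  rw [LinearMap.mem_ker.1 (radC_le_ker q hv), LinearMap.zero_apply]

theorem bilC_of_mem_radC_right {v : Fin n → ℂ} (hv : v ∈ radC q) (w : Fin n → ℂ) :
    bilC q w v = 0 := by
  rw [bilC_comm, bilC_of_mem_radC_left hv]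

theorem toC_injective : Function.Injective (toC : (Fin n → ℤ) → Fin n → ℂ) := by
  intro x y h
  ext i
  simpa [toC] using congrFun h i

theorem toC_neg (x : Fin n → ℤ) : toC (-x) = -toC x := by
  ext i; simp [toC]

theorem bilC_single_right (v : Fin n → ℂ) (j : Fin n) :
    bilC q v (Pi.single j 1) = ∑ i, v i * (gram q i j : ℂ) := by
  simp [bilC, Matrix.toBilin'_apply, Pi.single_apply]

/-- A rational vector in the kernel of the Gram matrix is a multiple of an element of `rad q`. -/
theorem ratCast_mem_radC (r : Fin n → ℚ) (hr : ∀ j, ∑ i, r i * (gram q i j : ℚ) = 0) :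
    (fun i => (r i : ℂ)) ∈ radC q := by
  obtain ⟨d, hd⟩ := IsLocalization.exist_integer_multiples_of_finite (nonZeroDivisors ℤ) r
  choose x hx using hd
  have hd0 : ((d : ℤ) : ℚ) ≠ 0 := by exact_mod_cast nonZeroDivisors.ne_zero d.2
  have hx' : ∀ i, (x i : ℚ) = (d : ℤ) * r i := by
    intro i
    have := hx i
    simpa [Algebra.smul_def] using this
  have hmem : x ∈ rad q := by
    refine mem_rad_of_polar_single fun j => ?_
    have h1 := bilC_toC q x (Pi.single j 1)
    rw [toC_single, bilC_single_right] at h1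
    have h2 : ∑ i, (x i : ℚ) * (gram q i j : ℚ) = 0 := by
      simp_rw [hx', mul_assoc, ← Finset.mul_sum, hr j, mul_zero]
    have h3 : ∑ i, (x i : ℂ) * (gram q i j : ℂ) = 0 := by exact_mod_cast h2
    rw [show ∑ i, toC x i * (gram q i j : ℂ) = 0 from h3] at h1
    exact_mod_cast h1.symm
  have : (fun i => (r i : ℂ)) = ((d : ℤ) : ℂ)⁻¹ • toC x := by
    ext i
    have h : (x i : ℂ) = (d : ℤ) * r i := by exact_mod_cast hx' i
    have hd1 : ((d : ℤ) : ℂ) ≠ 0 := by exact_mod_cast hd0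
    simp [toC, h, hd1]
  rw [this]
  exact Submodule.smul_mem _ _ (toC_mem_radC hmem)

/-- The kernel of `q(-, -)` on `ℂⁿ` is spanned by its integral vectors. A complex vector in the
kernel is expanded along a basis of `ℂ` over `ℚ`; since the Gram matrix is rational, all coefficient
vectors lie in its kernel. -/
theorem mem_radC_of_bilC {v : Fin n → ℂ} (hv : ∀ w, bilC q v w = 0) : v ∈ radC q := by
  classical
  let b := Module.Basis.ofVectorSpace ℚ ℂ
  let S := Finset.univ.biUnion fun i => (b.repr (v i)).support
  have hsum : v = ∑ k ∈ S, b k • (fun i => ((b.repr (v i) k : ℚ) : ℂ)) := by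
    ext i
    conv_lhs => rw [← b.linearCombination_repr (v i), Finsupp.linearCombination_apply,
      Finsupp.sum_of_support_subset (s := S) _
        (Finset.subset_biUnion_of_mem (fun i => (b.repr (v i)).support) (Finset.mem_univ i)) _
        (by simp)]
    simp [Rat.smul_def, mul_comm]
  rw [hsum]
  refine Submodule.sum_mem _ fun k _ => Submodule.smul_mem _ _ (ratCast_mem_radC _ fun j => ?_)
  have h := hv (Pi.single j 1)
  rw [bilC_single_right] at h
  have h2 := congrArg (b.coord k) h
  rw [map_sum, map_zero] at h2
  rw [← h2]
  refine Finset.sum_congr rfl fun i _ => ?_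
  have : v i * (gram q i j : ℂ) = (gram q i j : ℚ) • v i := by
    rw [Rat.smul_def, mul_comm]; norm_cast
  rw [this, map_smul, smul_eq_mul, mul_comm, Module.Basis.coord_apply]

/-- Integral vectors which are linearly independent over `ℤ` are linearly independent over `ℂ`:
the rational coordinates of a complex relation are rational relations. -/
theorem linearIndependent_toC {ι : Type*} {x : ι → Fin n → ℤ} (hx : LinearIndependent ℤ x) :
    LinearIndependent ℂ fun i => toC (x i) := by
  have hQ : LinearIndependent ℚ fun i => (fun j => (x i j : ℚ) : Fin n → ℚ) := by
    rw [← LinearIndependent.iff_fractionRing ℤ ℚ]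
    let f : (Fin n → ℤ) →ₗ[ℤ] (Fin n → ℚ) := (Int.castAddHom ℚ).toIntLinearMap.compLeft (Fin n)
    refine hx.map' f (LinearMap.ker_eq_bot.2 fun a b h => ?_)
    ext i
    have := congrFun h i
    simpa [f] using this
  rw [linearIndependent_iff'] at hQ ⊢
  intro s g hg i hi
  let b := Module.Basis.ofVectorSpace ℚ ℂ
  refine b.ext_elem fun k => ?_
  rw [map_zero, Finsupp.zero_apply]
  refine hQ s (fun i => b.repr (g i) k) ?_ i hi
  ext j
  have h := congrArg (b.coord k) (congrFun hg j)
  simp only [Finset.sum_apply, Pi.smul_apply, smul_eq_mul, map_sum, Pi.zero_apply, map_zero] at h ⊢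
  rw [← h]
  refine Finset.sum_congr rfl fun i _ => ?_
  have : g i * toC (x i) j = (x i j : ℚ) • g i := by
    rw [Rat.smul_def, mul_comm]; simp [toC]
  rw [this, map_smul, smul_eq_mul, mul_comm, Module.Basis.coord_apply]

end

section

/-! ### The bracket on generators -/

variable (F : RadFamily q) {B : LinearMap.BilinForm ℤ (Fin n → ℤ)}
  (ρ : (Fin n → ℂ) →ₗ[ℂ] radC q)

theorem proj_toC_self {F : RadFamily q} (hF : ∀ σ : rad q, toC (σ : Fin n → ℤ) ∈ F.W σ)
    (σ : Fin n → ℤ) : proj F σ (toC σ) = 0 := by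
  by_cases h : σ ∈ rad q
  · rw [proj_of F h, (Submodule.Quotient.mk_eq_zero _).2 (hF ⟨σ, h⟩), map_zero, map_zero]
  · exact proj_ne F h _

theorem proj_add_eq_zero {F : RadFamily q} (hF : ∀ σ : rad q, toC (σ : Fin n → ℤ) ∈ F.W σ)
    (σ τ : Fin n → ℤ) : proj F (σ + τ) (toC σ) + proj F (σ + τ) (toC τ) = 0 := by
  rw [← map_add, ← toC_add, proj_toC_self hF]

theorem bracket_inDual_e_apply (β : Fin n → ℤ) (ξ : Module.Dual ℂ (radC q)) :
    bracket F B ρ (inDual F ξ) (e F β) = ξ (ρ (toC β)) • e F β := by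
  by_cases h : q β = 1
  · exact bracket_inDual_e F B ρ h ξ
  · simp [e_ne F h]

theorem bracket_inDual_proj_apply (τ : Fin n → ℤ) (w : Fin n → ℂ) (ξ : Module.Dual ℂ (radC q)) :
    bracket F B ρ (inDual F ξ) (proj F τ w) = ξ (ρ (toC τ)) • proj F τ w := by
  by_cases h : τ ∈ rad q
  · exact bracket_inDual_proj F B ρ h w ξ
  · simp [proj_ne F h]

theorem bracket_proj_e_apply {σ : Fin n → ℤ} (hσ : σ ∈ rad q) (β : Fin n → ℤ) (v : Fin n → ℂ) :
    bracket F B ρ (proj F σ v) (e F β) = (eps B σ β * bilC q v (toC β)) • e F (β + σ) := by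
  by_cases h : q β = 1
  · exact bracket_proj_e F B ρ hσ h v
  · have h' : q (β + σ) ≠ 1 := by rwa [map_add_of_mem_rad hσ]
    simp [e_ne F h, e_ne F h']

variable {F} in
/-- Induction over the generators `e_α`, `π_σ(v)` and `ξ`. -/
theorem alg_induction {p : Alg F → Prop}
    (he : ∀ α, q α = 1 → p (e F α)) (hp : ∀ σ ∈ rad q, ∀ v, p (proj F σ v))
    (hx : ∀ ξ, p (inDual F ξ)) (hadd : ∀ x y, p x → p y → p (x + y))
    (hsmul : ∀ (c : ℂ) x, p x → p (c • x)) (x : Alg F) : p x := by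
  let S : Submodule ℂ (Alg F) :=
    { carrier := {x | p x}
      zero_mem' := by simpa using hx 0
      add_mem' := fun h h' => hadd _ _ h h'
      smul_mem' := fun c _ h => hsmul c _ h }
  have hS : S.mkQ = 0 := by
    refine alg_hom_ext _ (fun α hα => ?_) (fun σ hσ v => ?_) fun ξ => ?_ <;>
      simp only [LinearMap.zero_apply, Submodule.mkQ_apply, Submodule.Quotient.mk_eq_zero]
    · exact he α hα
    · exact hp σ hσ v
    · exact hx ξ
  exact (Submodule.Quotient.mk_eq_zero S).1 (LinearMap.congr_fun hS x)

variable {F} in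
/-- A permutation invariant property of triples, linear in the first entry, has to be checked only
on unordered triples of generators. -/
theorem alg_induction_triple {T : Alg F → Alg F → Alg F → Prop}
    (hadd : ∀ x x' y z, T x y z → T x' y z → T (x + x') y z)
    (hsmul : ∀ (c : ℂ) x y z, T x y z → T (c • x) y z)
    (rot : ∀ x y z, T x y z → T y z x) (swap : ∀ x y z, T x y z → T y x z)
    (eee : ∀ α, q α = 1 → ∀ β, q β = 1 → ∀ γ, q γ = 1 → T (e F α) (e F β) (e F γ))
    (eep : ∀ α, q α = 1 → ∀ β, q β = 1 → ∀ σ ∈ rad q, ∀ v, T (e F α) (e F β) (proj F σ v))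
    (eex : ∀ α, q α = 1 → ∀ β, q β = 1 → ∀ ξ, T (e F α) (e F β) (inDual F ξ))
    (epp : ∀ α, q α = 1 → ∀ σ ∈ rad q, ∀ v, ∀ τ ∈ rad q, ∀ w,
      T (e F α) (proj F σ v) (proj F τ w))
    (epx : ∀ α, q α = 1 → ∀ σ ∈ rad q, ∀ v ξ, T (e F α) (proj F σ v) (inDual F ξ))
    (exx : ∀ α, q α = 1 → ∀ ξ ζ, T (e F α) (inDual F ξ) (inDual F ζ))
    (ppp : ∀ σ ∈ rad q, ∀ v, ∀ τ ∈ rad q, ∀ w, ∀ υ ∈ rad q, ∀ u,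
      T (proj F σ v) (proj F τ w) (proj F υ u))
    (ppx : ∀ σ ∈ rad q, ∀ v, ∀ τ ∈ rad q, ∀ w ξ, T (proj F σ v) (proj F τ w) (inDual F ξ))
    (pxx : ∀ σ ∈ rad q, ∀ v ξ ζ, T (proj F σ v) (inDual F ξ) (inDual F ζ))
    (xxx : ∀ ξ ζ η, T (inDual F ξ) (inDual F ζ) (inDual F η)) (x y z : Alg F) : T x y z := by
  have rot2 : ∀ x y z, T x y z → T z x y := fun x y z h => rot _ _ _ (rot _ _ _ h)
  have swap2 : ∀ x y z, T x y z → T x z y := fun x y z h => rot _ _ _ (swap _ _ _ h)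
  have swap3 : ∀ x y z, T x y z → T z y x := fun x y z h => swap _ _ _ (rot _ _ _ h)
  have add2 : ∀ x y y' z, T x y z → T x y' z → T x (y + y') z := fun x y y' z h h' =>
    swap _ _ _ (hadd _ _ _ _ (swap _ _ _ h) (swap _ _ _ h'))
  have add3 : ∀ x y z z', T x y z → T x y z' → T x y (z + z') := fun x y z z' h h' =>
    rot _ _ _ (hadd _ _ _ _ (rot2 _ _ _ h) (rot2 _ _ _ h'))
  have smul2 : ∀ (c : ℂ) x y z, T x y z → T x (c • y) z := fun c x y z h =>
    swap _ _ _ (hsmul c _ _ _ (swap _ _ _ h))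
  have smul3 : ∀ (c : ℂ) x y z, T x y z → T x y (c • z) := fun c x y z h =>
    rot _ _ _ (hsmul c _ _ _ (rot2 _ _ _ h))
  have ind3 : ∀ {x y : Alg F}, (∀ α, q α = 1 → T x y (e F α)) →
      (∀ σ ∈ rad q, ∀ v, T x y (proj F σ v)) → (∀ ξ, T x y (inDual F ξ)) → ∀ z, T x y z :=
    fun h1 h2 h3 => alg_induction h1 h2 h3 (fun _ _ => add3 _ _ _ _) fun c _ => smul3 c _ _ _
  have ind2 : ∀ {x : Alg F}, (∀ α, q α = 1 → ∀ z, T x (e F α) z) →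
      (∀ σ ∈ rad q, ∀ v z, T x (proj F σ v) z) → (∀ ξ z, T x (inDual F ξ) z) → ∀ y z, T x y z :=
    fun h1 h2 h3 => alg_induction h1 h2 h3 (fun _ _ h h' z => add2 _ _ _ _ (h z) (h' z))
      fun c _ h z => smul2 c _ _ _ (h z)
  refine alg_induction (p := fun x => ∀ y z, T x y z)
    (fun α hα => ind2
      (fun β hβ => ind3 (fun γ hγ => eee α hα β hβ γ hγ) (fun σ hσ v => eep α hα β hβ σ hσ v)
        (fun ξ => eex α hα β hβ ξ))
      (fun σ hσ v => ind3 (fun γ hγ => swap2 _ _ _ (eep α hα γ hγ σ hσ v))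
        (fun τ hτ w => epp α hα σ hσ v τ hτ w) (fun ξ => epx α hα σ hσ v ξ))
      (fun ξ => ind3 (fun γ hγ => swap2 _ _ _ (eex α hα γ hγ ξ))
        (fun τ hτ w => swap2 _ _ _ (epx α hα τ hτ w ξ)) (fun ζ => exx α hα ξ ζ)))
    (fun σ hσ v => ind2
      (fun β hβ => ind3 (fun γ hγ => rot2 _ _ _ (eep β hβ γ hγ σ hσ v))
        (fun τ hτ w => swap _ _ _ (epp β hβ σ hσ v τ hτ w))
        (fun ξ => swap _ _ _ (epx β hβ σ hσ v ξ)))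
      (fun τ hτ w => ind3 (fun γ hγ => rot _ _ _ (epp γ hγ σ hσ v τ hτ w))
        (fun υ hυ u => ppp σ hσ v τ hτ w υ hυ u) (fun ξ => ppx σ hσ v τ hτ w ξ))
      (fun ξ => ind3 (fun γ hγ => rot _ _ _ (epx γ hγ σ hσ v ξ))
        (fun τ hτ w => swap2 _ _ _ (ppx σ hσ v τ hτ w ξ)) (fun ζ => pxx σ hσ v ξ ζ)))
    (fun ξ => ind2
      (fun β hβ => ind3 (fun γ hγ => rot2 _ _ _ (eex β hβ γ hγ ξ))
        (fun τ hτ w => rot2 _ _ _ (epx β hβ τ hτ w ξ))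
        (fun ζ => swap _ _ _ (exx β hβ ξ ζ)))
      (fun τ hτ w => ind3 (fun γ hγ => swap3 _ _ _ (epx γ hγ τ hτ w ξ))
        (fun υ hυ u => rot2 _ _ _ (ppx τ hτ w υ hυ u ξ))
        (fun ζ => swap _ _ _ (pxx τ hτ w ξ ζ)))
      (fun ζ => ind3 (fun γ hγ => rot _ _ _ (exx γ hγ ξ ζ))
        (fun υ hυ u => rot _ _ _ (pxx υ hυ u ξ ζ)) (fun η => xxx ξ ζ η)))
    (fun x x' h h' y z => hadd x x' y z (h y z) (h' y z))
    (fun c x h y z => hsmul c x y z (h y z)) x y z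

/-! ### The Jacobi identity -/

variable {F}


theorem bracket_skew (hF : ∀ σ : rad q, toC (σ : Fin n → ℤ) ∈ F.W σ)
    (hq : IsNonneg q) (hB : ∀ x, B x x = q x)
    (x y : Alg F) : bracket F B ρ x y = -bracket F B ρ y x := by
  have : bracket F B ρ = -(bracket F B ρ).flip := by
    refine alg_hom_ext _ (fun α hα => alg_hom_ext _ (fun β hβ => ?_) (fun τ hτ w => ?_) fun ζ => ?_)
      (fun σ hσ v => alg_hom_ext _ (fun β hβ => ?_) (fun τ hτ w => ?_) fun ζ => ?_)
      (fun ξ => alg_hom_ext _ (fun β hβ => ?_) (fun τ hτ w => ?_) fun ζ => ?_) <;>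
    simp only [LinearMap.neg_apply, LinearMap.flip_apply, bracket_e_e, bracket_e_proj,
      bracket_proj_e, bracket_proj_proj, bracket_e_inDual, bracket_inDual_e, bracket_proj_inDual,
      bracket_inDual_proj, bracket_inDual_inDual, neg_neg, neg_zero, *]
    -- only the values `q(α, β) = -2` and `-1` give a non-zero bracket `[e_α, e_β]`
    · have h2 := neg_two_le_polar hq hα hβ
      have hadd := map_add_eq (q := q) α β
      have hs := eps_swap hB α β
      rw [add_comm β α]
      rcases eq_or_ne (QuadraticMap.polar q α β) (-2) with h | h
      · have h1 : q (α + β) ≠ 1 := by omega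
        have hp := proj_add_eq_zero hF α β
        rw [hs, h, e_ne F h1, eq_neg_of_add_eq_zero_right hp]
        norm_num
      rcases eq_or_ne (QuadraticMap.polar q α β) (-1) with h' | h'
      · have h1 : q (α + β) ≠ 0 := by omega
        rw [hs, h', proj_ne F (not_mem_rad_of_map_ne h1), proj_ne F (not_mem_rad_of_map_ne h1)]
        norm_num
      · have h0 : q (α + β) ≠ 0 := by omega
        have h1 : q (α + β) ≠ 1 := by omega
        simp [proj_ne F (not_mem_rad_of_map_ne h0), e_ne F h1]
    · rw [eps_rad_comm hB hσ τ, bilC_comm q w v, add_comm τ σ,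
        eq_neg_of_add_eq_zero_right (proj_add_eq_zero hF σ τ)]
      simp
  exact LinearMap.congr_fun (LinearMap.congr_fun this x) y

/-- The double bracket of three basis vectors. -/
theorem bracket_e_bracket_e_e (hq : IsNonneg q) (hB : ∀ x, B x x = q x)
    {α β γ : Fin n → ℤ} (hα : q α = 1) (hβ : q β = 1)
    (hγ : q γ = 1) :
    bracket F B ρ (e F α) (bracket F B ρ (e F β) (e F γ)) =
      if QuadraticMap.polar q β γ = -1 then
        (eps B β γ * eps B α β * eps B α γ) •
          (e F (α + β + γ) + proj F (α + β + γ) (toC α))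
      else if QuadraticMap.polar q β γ = -2 then
        -((eps B β γ * eps B α β * eps B α γ * ((QuadraticMap.polar q α β : ℤ) : ℂ)) •
          e F (α + β + γ))
      else 0 := by
  have hadd := map_add_eq (q := q) β γ
  have h2 := neg_two_le_polar hq hβ hγ
  rw [bracket_e_e F B ρ hβ hγ, map_smul, map_add]
  split_ifs with h h'
  · have h0 : q (β + γ) ≠ 0 := by omega
    have h1 : q (β + γ) = 1 := by omega
    rw [proj_ne F (not_mem_rad_of_map_ne h0), map_zero, add_zero, bracket_e_e F B ρ hα h1,
      eps_add_right, smul_smul, ← add_assoc, mul_assoc]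
  · have h0 : β + γ ∈ rad q := (mem_rad_iff hq).2 (by omega)
    have h1 : q (β + γ) ≠ 1 := by omega
    rw [e_ne F h1, map_zero, zero_add, bracket_e_proj F B ρ h0 hα, ← eps_rad_comm hB h0,
      eps_add_right, bilC_toC, QuadraticMap.polar_comm q β α, smul_neg, smul_smul, ← add_assoc]
    simp only [mul_assoc]
  · have h0 : q (β + γ) ≠ 0 := by omega
    have h1 : q (β + γ) ≠ 1 := by omega
    simp [proj_ne F (not_mem_rad_of_map_ne h0), e_ne F h1]

theorem jacobi_e_e_e (hF : ∀ σ : rad q, toC (σ : Fin n → ℤ) ∈ F.W σ)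
    (hq : IsNonneg q) (hB : ∀ x, B x x = q x)
    {α β γ : Fin n → ℤ} (hα : q α = 1) (hβ : q β = 1)
    (hγ : q γ = 1) :
    bracket F B ρ (e F α) (bracket F B ρ (e F β) (e F γ)) +
      bracket F B ρ (e F β) (bracket F B ρ (e F γ) (e F α)) +
      bracket F B ρ (e F γ) (bracket F B ρ (e F α) (e F β)) = 0 := by
  rw [bracket_e_bracket_e_e ρ hq hB hα hβ hγ, bracket_e_bracket_e_e ρ hq hB hβ hγ hα,
    bracket_e_bracket_e_e ρ hq hB hγ hα hβ, show β + γ + α = α + β + γ by abel,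
    show γ + α + β = α + β + γ by abel, eps_swap hB α β, eps_swap hB β γ, eps_swap hB γ α,
    QuadraticMap.polar_comm q γ α]
  have hab := neg_two_le_polar hq hα hβ
  have hbc := neg_two_le_polar hq hβ hγ
  have hac := neg_two_le_polar hq hα hγ
  have hab' := polar_le_two hq hα hβ
  have hbc' := polar_le_two hq hβ hγ
  have hac' := polar_le_two hq hα hγ
  have hs : q (α + β + γ) = 3 + QuadraticMap.polar q α β + QuadraticMap.polar q β γ
      + QuadraticMap.polar q α γ := by
    rw [map_add_eq, map_add_eq, QuadraticMap.polar_add_left, hα, hβ, hγ]; ring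
  have key : ∀ {x y z : Fin n → ℤ}, q x = 1 → q y = 1 → QuadraticMap.polar q x y = -2 →
      QuadraticMap.polar q x z = -QuadraticMap.polar q y z := by
    intro x y z hx hy h
    have hr : x + y ∈ rad q := (mem_rad_iff hq).2 (by rw [map_add_eq, hx, hy, h]; rfl)
    have := polar_of_mem_rad hr z
    rw [QuadraticMap.polar_add_left] at this
    omega
  -- the value `-2` on a pair makes the two remaining values opposite
  have k1 := key (z := γ) hα hβ
  have k2 := key (z := α) hβ hγ
  have k3 := key (z := β) hα hγ
  rw [QuadraticMap.polar_comm q β α, QuadraticMap.polar_comm q γ α] at k2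
  rw [QuadraticMap.polar_comm q γ β] at k3
  have hp := proj_toC_self hF (α + β + γ)
  rw [toC_add, toC_add, map_add, map_add] at hp
  generalize eps B α β = x, eps B β γ = y, eps B γ α = z at *
  by_cases h0 : α + β + γ ∈ rad q
  -- here all three values are `-1`, and the sum is a multiple of `π_σ(σ)` with `σ = α + β + γ`
  · have h1 : q (α + β + γ) ≠ 1 := by rw [map_of_mem_rad h0]; norm_num
    have ha := polar_of_mem_rad h0 α
    have hb := polar_of_mem_rad h0 β
    have hc := polar_of_mem_rad h0 γ
    simp only [QuadraticMap.polar_add_left, polar_self_eq, hα, hβ, hγ,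
      QuadraticMap.polar_comm q β α, QuadraticMap.polar_comm q γ α,
      QuadraticMap.polar_comm q γ β] at ha hb hc
    have ha' : QuadraticMap.polar q α β = -1 := by omega
    have hb' : QuadraticMap.polar q β γ = -1 := by omega
    have hc' : QuadraticMap.polar q α γ = -1 := by omega
    simp only [ha', hb', hc', e_ne F h1]
    norm_num
    linear_combination (norm := module) (-(x * y * z)) • hp
  · simp only [proj_ne F h0, add_zero]
    by_cases h1 : q (α + β + γ) = 1
    · generalize QuadraticMap.polar q α β = a, QuadraticMap.polar q β γ = b,
        QuadraticMap.polar q α γ = c at *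
      obtain rfl : c = -2 - a - b := by omega
      interval_cases a <;> interval_cases b <;> (try omega) <;> norm_num <;> module
    · simp [e_ne F h1]

end

section

variable {F : RadFamily q}
  {B : LinearMap.BilinForm ℤ (Fin n → ℤ)} (ρ : (Fin n → ℂ) →ₗ[ℂ] radC q)

theorem jacobi_e_e_proj (hF : ∀ σ : rad q, toC (σ : Fin n → ℤ) ∈ F.W σ)
    (hq : IsNonneg q) (hB : ∀ x, B x x = q x) {α β σ : Fin n → ℤ} (hα : q α = 1) (hβ : q β = 1)
    (hσ : σ ∈ rad q) (v : Fin n → ℂ) :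
    bracket F B ρ (e F α) (bracket F B ρ (e F β) (proj F σ v)) +
      bracket F B ρ (e F β) (bracket F B ρ (proj F σ v) (e F α)) +
      bracket F B ρ (proj F σ v) (bracket F B ρ (e F α) (e F β)) = 0 := by
  have hα' : q (α + σ) = 1 := by rw [map_add_of_mem_rad hσ, hα]
  have hβ' : q (β + σ) = 1 := by rw [map_add_of_mem_rad hσ, hβ]
  rw [bracket_e_proj F B ρ hσ hβ, bracket_proj_e F B ρ hσ hα, map_neg, map_smul, map_smul,
    bracket_e_e F B ρ hα hβ', bracket_e_e F B ρ hβ hα', bracket_e_e F B ρ hα hβ, map_smul, map_add,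
    bracket_proj_e_apply F ρ hσ, eps_add_right, eps_add_right, eps_add_right,
    eps_rad_comm hB hσ, eps_rad_comm hB hσ, eps_swap hB α β, toC_add, map_add,
    show α + (β + σ) = α + β + σ by abel, show β + (α + σ) = α + β + σ by abel]
  have hadd := map_add_eq (q := q) α β
  have h2 := neg_two_le_polar hq hα hβ
  have hs := map_add_of_mem_rad hσ (α + β)
  by_cases h0 : α + β ∈ rad q
  · have hp := proj_toC_self hF (α + β + σ)
    rw [toC_add, toC_add, map_add, map_add] at hp
    have h1 := map_of_mem_rad h0
    have h : QuadraticMap.polar q α β = -2 := by omega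
    have hv := bilC_of_mem_radC_right (toC_mem_radC h0) v
    rw [toC_add, map_add] at hv
    rw [bracket_proj_proj F B ρ hσ h0, add_comm σ, e_ne F (by omega : q (α + β + σ) ≠ 1), h,
      eps_add_right, eq_neg_of_add_eq_zero_right hv]
    norm_num
    linear_combination (norm := module) (eps B α β * eps B σ α * eps B σ β * bilC q v (toC α)) • hp
  · have h0' : q (α + β) ≠ 0 := fun h => h0 ((mem_rad_iff hq).2 h)
    have h0'' : α + β + σ ∉ rad q := not_mem_rad_of_map_ne (by omega)
    simp only [proj_ne F h0, proj_ne F h0'', map_zero]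
    by_cases h1 : q (α + β) = 1
    · have h : QuadraticMap.polar q α β = -1 := by omega
      rw [h]
      norm_num
      module
    · simp [e_ne F (by omega : q (α + β + σ) ≠ 1)]

theorem jacobi_e_proj_proj (hB : ∀ x, B x x = q x) {α σ τ : Fin n → ℤ} (hα : q α = 1)
    (hσ : σ ∈ rad q) (v : Fin n → ℂ) (hτ : τ ∈ rad q) (w : Fin n → ℂ) :
    bracket F B ρ (e F α) (bracket F B ρ (proj F σ v) (proj F τ w)) +
      bracket F B ρ (proj F σ v) (bracket F B ρ (proj F τ w) (e F α)) +
      bracket F B ρ (proj F τ w) (bracket F B ρ (e F α) (proj F σ v)) = 0 := by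
  have hα' : q (α + σ) = 1 := by rw [map_add_of_mem_rad hσ, hα]
  have hα'' : q (α + τ) = 1 := by rw [map_add_of_mem_rad hτ, hα]
  rw [bracket_proj_proj F B ρ hσ hτ, bracket_proj_e F B ρ hτ hα, bracket_e_proj F B ρ hσ hα,
    map_smul, map_smul, map_neg, map_smul, bracket_e_proj F B ρ (add_mem hσ hτ) hα,
    bracket_proj_e F B ρ hσ hα'', bracket_proj_e F B ρ hτ hα',
    bilC_of_mem_radC_left (toC_mem_radC hσ), eps_add_right, eps_add_right, toC_add, toC_add,
    map_add, map_add, bilC_of_mem_radC_right (toC_mem_radC hσ),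
    bilC_of_mem_radC_right (toC_mem_radC hτ), eps_rad_comm hB hσ τ, add_right_comm α τ σ]
  module

/-- The bracket of `⨁ ℂ e_α ⊕ ⨁ ℂⁿ/W_σ ⊕ (rad_ℂ q)^*` is a Lie bracket as soon as `σ ∈ W_σ` for all
`σ ∈ rad q`. -/
theorem isLieBracket (hF : ∀ σ : rad q, toC (σ : Fin n → ℤ) ∈ F.W σ)
    (hq : IsNonneg q) (hB : ∀ x, B x x = q x) : EALA.IsLieBracket (bracket F B ρ) := by
  have skew := bracket_skew ρ hF hq hB
  have self : ∀ x, bracket F B ρ x x = 0 := by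
    intro x
    have h : (2 : ℂ) • bracket F B ρ x x = 0 := by
      rw [two_smul]
      exact eq_neg_iff_add_eq_zero.1 (skew x x)
    simpa using h
  refine ⟨self, alg_induction_triple ?_ ?_ ?_ ?_
    (fun α hα β hβ γ hγ => jacobi_e_e_e ρ hF hq hB hα hβ hγ)
    (fun α hα β hβ σ hσ v => jacobi_e_e_proj ρ hF hq hB hα hβ hσ v) ?_
    (fun α hα σ hσ v τ hτ w => jacobi_e_proj_proj ρ hB hα hσ v hτ w) ?_ ?_ ?_ ?_ ?_ ?_⟩
  · intro x x' y z h h'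
    simp only [map_add, LinearMap.add_apply]
    linear_combination (norm := module) h + h'
  · intro c x y z h
    simp only [map_smul, LinearMap.smul_apply]
    linear_combination (norm := module) c • h
  · intro x y z h
    rw [← h]; abel
  · intro x y z h
    rw [skew y x, skew x z, skew z y, map_neg, map_neg, map_neg, ← neg_add, ← neg_add,
      neg_eq_zero, ← h]
    abel
  · intro α hα β hβ ξ
    rw [skew (e F β) (inDual F ξ), bracket_e_e F B ρ hα hβ]
    simp only [bracket_inDual_e_apply, bracket_inDual_proj_apply, map_neg, map_smul, map_add]
    rw [skew (e F β) (e F α), bracket_e_e F B ρ hα hβ, toC_add, map_add, map_add]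
    module
  · intro α hα σ hσ v ξ
    rw [skew (proj F σ v) (inDual F ξ), bracket_e_proj F B ρ hσ hα]
    simp only [bracket_inDual_e_apply, bracket_inDual_proj_apply, map_neg, map_smul]
    rw [bracket_e_proj F B ρ hσ hα, bracket_proj_e F B ρ hσ hα, toC_add, map_add, map_add]
    module
  · intro α hα ξ ζ
    rw [skew (e F α) (inDual F ξ)]
    simp only [bracket_inDual_inDual, bracket_inDual_e_apply, map_neg, map_smul, map_zero]
    module
  · intro σ hσ v τ hτ w υ hυ u
    simp only [bracket_proj_proj F B ρ hσ hτ, bracket_proj_proj F B ρ hτ hυ,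
      bracket_proj_proj F B ρ hυ hσ, map_smul, bracket_proj_proj F B ρ hσ (add_mem hτ hυ),
      bracket_proj_proj F B ρ hτ (add_mem hυ hσ), bracket_proj_proj F B ρ hυ (add_mem hσ hτ),
      bilC_of_mem_radC_right (toC_mem_radC hσ), bilC_of_mem_radC_right (toC_mem_radC hτ),
      bilC_of_mem_radC_right (toC_mem_radC hυ)]
    simp
  · intro σ hσ v τ hτ w ξ
    rw [skew (proj F τ w) (inDual F ξ), bracket_proj_proj F B ρ hσ hτ]
    simp only [bracket_inDual_proj_apply, map_neg, map_smul]
    rw [skew (proj F τ w) (proj F σ v), bracket_proj_proj F B ρ hσ hτ, toC_add, map_add, map_add]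
    module
  · intro σ hσ v ξ ζ
    rw [skew (proj F σ v) (inDual F ξ)]
    simp only [bracket_inDual_inDual, bracket_inDual_proj_apply, map_neg, map_smul, map_zero]
    module
  · intro ξ ζ η
    simp [bracket_inDual_inDual]

/-! ### The invariant form -/

theorem form_e_e {α β : Fin n → ℤ} (hα : q α = 1) (hβ : q β = 1) :
    form F ρ (e F α) (e F β) = if α + β = 0 then -1 else 0 := by
  simp [e_of F hα, e_of F hβ, form, foEE]

theorem form_e_proj (α σ : Fin n → ℤ) (v : Fin n → ℂ) :
    form F ρ (e F α) (proj F σ v) = 0 := by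
  unfold e proj
  split_ifs <;> simp [form]

theorem form_e_inDual (α : Fin n → ℤ) (ξ : Module.Dual ℂ (radC q)) :
    form F ρ (e F α) (inDual F ξ) = 0 := by
  unfold e
  split_ifs <;> simp [form]

theorem form_proj_proj {σ τ : Fin n → ℤ} (hσ : σ ∈ rad q) (hτ : τ ∈ rad q) (v w : Fin n → ℂ) :
    form F ρ (proj F σ v) (proj F τ w) = if σ + τ = 0 then bilC q v w else 0 := by
  have h : (⟨σ, hσ⟩ + ⟨τ, hτ⟩ : rad q) = 0 ↔ σ + τ = 0 := by
    rw [Subtype.ext_iff]; rfl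
  simp only [proj_of F hσ, proj_of F hτ, form, foPP]
  simp only [LinearMap.add_apply, LinearMap.compl₁₂_apply, fstE_inP, sndP_inP, trdX_inP,
    LinearMap.flip_apply, map_zero, LinearMap.zero_apply, DirectSum.toModule_lof, add_zero,
    zero_add, h]
  split_ifs <;> simp

theorem form_inDual_proj {τ : Fin n → ℤ} (hτ : τ ∈ rad q) (ξ : Module.Dual ℂ (radC q))
    (w : Fin n → ℂ) : form F ρ (inDual F ξ) (proj F τ w) = if τ = 0 then ξ (ρ w) else 0 := by
  have h : (⟨τ, hτ⟩ : rad q) = 0 ↔ τ = 0 := by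
    rw [Subtype.ext_iff]; rfl
  simp only [proj_of F hτ, form, foXP]
  simp only [LinearMap.add_apply, LinearMap.compl₁₂_apply, fstE_inP, sndP_inP, trdX_inP,
    fstE_inDual, sndP_inDual, trdX_inDual,
    LinearMap.flip_apply, map_zero, LinearMap.zero_apply, DirectSum.toModule_lof, add_zero,
    zero_add, Submodule.liftQ_apply, h]
  split_ifs <;> simp

theorem form_inDual_inDual (ξ ζ : Module.Dual ℂ (radC q)) :
    form F ρ (inDual F ξ) (inDual F ζ) = 0 := by
  simp [form]

theorem form_symm (x y : Alg F) : form F ρ x y = form F ρ y x := by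
  have hX : ∀ x y : Alg F, ((foXP F ρ).compl₁₂ (trdX F) (sndP F)).flip x y =
    (foXP F ρ).compl₁₂ (trdX F) (sndP F) y x := fun x y => rfl
  have hE : (foEE (q := q)) = (foEE (q := q)).flip := by
    refine Finsupp.lhom_ext' fun α => LinearMap.ext_ring ?_
    refine Finsupp.lhom_ext' fun β => LinearMap.ext_ring ?_
    simp [foEE, add_comm]
  have hP : foPP F = (foPP F).flip := by
    refine DirectSum.linearMap_ext ℂ fun σ => Submodule.linearMap_qext _ (LinearMap.ext fun v => ?_)
    refine DirectSum.linearMap_ext ℂ fun τ => Submodule.linearMap_qext _ (LinearMap.ext fun w => ?_)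
    simp only [foPP, LinearMap.comp_apply, LinearMap.flip_apply, DirectSum.toModule_lof,
      Submodule.mkQ_apply, add_comm τ σ]
    split_ifs
    · simp [bilC_comm q v w]
    · simp
  have h1 := LinearMap.congr_fun (LinearMap.congr_fun hE (fstE F x)) (fstE F y)
  have h2 := LinearMap.congr_fun (LinearMap.congr_fun hP (sndP F x)) (sndP F y)
  simp only [LinearMap.flip_apply] at h1 h2
  simp only [form, LinearMap.add_apply, LinearMap.compl₁₂_apply, LinearMap.flip_apply, h1, h2]
  ring

end

section

variable {F : RadFamily q}
  {B : LinearMap.BilinForm ℤ (Fin n → ℤ)} (ρ : (Fin n → ℂ) →ₗ[ℂ] radC q)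

theorem form_e_e_apply (α : Fin n → ℤ) {β : Fin n → ℤ} (hβ : q β = 1) :
    form F ρ (e F α) (e F β) = if α + β = 0 then -1 else 0 := by
  by_cases h : q α = 1
  · exact form_e_e ρ h hβ
  · rw [e_ne F h, map_zero, LinearMap.zero_apply, if_neg]
    intro h0
    rw [eq_neg_of_add_eq_zero_left h0, QuadraticMap.map_neg] at h
    exact h hβ

theorem form_proj_proj_apply (σ : Fin n → ℤ) {τ : Fin n → ℤ} (hτ : τ ∈ rad q)
    (v w : Fin n → ℂ) :
    form F ρ (proj F σ v) (proj F τ w) = if σ + τ = 0 then bilC q v w else 0 := by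
  by_cases h : σ ∈ rad q
  · exact form_proj_proj ρ h hτ v w
  · rw [proj_ne F h, map_zero, LinearMap.zero_apply, if_neg]
    intro h0
    rw [eq_neg_of_add_eq_zero_left h0] at h
    exact h (neg_mem hτ)

theorem form_proj_inDual (τ : Fin n → ℤ) (ξ : Module.Dual ℂ (radC q))
    (w : Fin n → ℂ) : form F ρ (proj F τ w) (inDual F ξ) = if τ = 0 then ξ (ρ w) else 0 := by
  by_cases h : τ ∈ rad q
  · rw [form_symm, form_inDual_proj ρ h]
  · rw [proj_ne F h, map_zero, LinearMap.zero_apply, if_neg]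
    rintro rfl
    exact h (zero_mem _)

theorem form_proj_e (α σ : Fin n → ℤ) (v : Fin n → ℂ) :
    form F ρ (proj F σ v) (e F α) = 0 := by
  rw [form_symm, form_e_proj]

theorem form_inDual_e (α : Fin n → ℤ) (ξ : Module.Dual ℂ (radC q)) :
    form F ρ (inDual F ξ) (e F α) = 0 := by
  rw [form_symm, form_e_inDual]

theorem eps_self (hB : ∀ x, B x x = q x) {α : Fin n → ℤ} (hα : q α = 1) : eps B α α = -1 := by
  rw [eps, hB, hα, zpow_one]

theorem eps_self_of_mem_rad (hB : ∀ x, B x x = q x) {σ : Fin n → ℤ} (hσ : σ ∈ rad q) :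
    eps B σ σ = 1 := by
  rw [eps, hB, map_of_mem_rad hσ, zpow_zero]

theorem eps_neg_left (α β : Fin n → ℤ) : eps B (-α) β = eps B α β := by
  rw [eps, eps, map_neg, LinearMap.neg_apply, zpow_neg, ← inv_zpow]
  norm_num

/-- The summand `π_{α+β}(α)` of `[e_α, e_β]` is orthogonal to `e_γ`, and `(e_{α+β}, e_γ) = -1` if
`α + β + γ = 0`. -/
theorem form_bracket_e_e_e {α β γ : Fin n → ℤ} (hα : q α = 1) (hβ : q β = 1)
    (hγ : q γ = 1) : form F ρ (bracket F B ρ (e F α) (e F β)) (e F γ) =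
      if α + β + γ = 0 then -eps B α β else 0 := by
  rw [bracket_e_e F B ρ hα hβ, map_smul, LinearMap.smul_apply, map_add, LinearMap.add_apply,
    form_e_e_apply ρ _ hγ, form_proj_e]
  split_ifs <;> simp

theorem eps_rotate (hB : ∀ x, B x x = q x) {α β γ : Fin n → ℤ} (hα : q α = 1) (hβ : q β = 1)
    (hγ : q γ = 1) (h : α + β + γ = 0) : eps B β γ = eps B α β := by
  have hadd := map_add_eq (q := q) α β
  rw [eq_neg_of_add_eq_zero_left h, QuadraticMap.map_neg, hα, hβ, hγ] at hadd
  rw [eq_neg_of_add_eq_zero_right h, eps_neg_right, eps_add_right, eps_self hB hβ, eps_swap hB α β,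
    show QuadraticMap.polar q α β = -1 by omega]
  norm_num

/-- The trilinear form `([x, y], z)` is invariant under cyclic permutations. -/
theorem form_bracket_rotate (hF : ∀ σ : rad q, toC (σ : Fin n → ℤ) ∈ F.W σ)
    (hq : IsNonneg q) (hB : ∀ x, B x x = q x) (x y z : Alg F) :
    form F ρ (bracket F B ρ x y) z = form F ρ (bracket F B ρ y z) x := by
  have skew := bracket_skew ρ hF hq hB
  refine And.left (b := form F ρ (bracket F B ρ y z) x = form F ρ (bracket F B ρ z x) y) ?_
  revert x y z
  refine alg_induction_triple ?_ ?_ ?_ ?_ ?_ ?_ ?_ ?_ ?_ ?_ ?_ ?_ ?_ ?_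
  · rintro x x' y z ⟨h1, h2⟩ ⟨h1', h2'⟩
    simp only [map_add, LinearMap.add_apply, h1, h2, h1', h2', and_self]
  · rintro c x y z ⟨h1, h2⟩
    simp only [map_smul, LinearMap.smul_apply, h1, h2, and_self]
  · rintro x y z ⟨h1, h2⟩
    exact ⟨h2, (h1.trans h2).symm⟩
  · rintro x y z ⟨h1, h2⟩
    rw [skew y x, skew x z, skew z y, map_neg, map_neg, map_neg, LinearMap.neg_apply,
      LinearMap.neg_apply, LinearMap.neg_apply, h1, h2]
    exact ⟨rfl, rfl⟩
  · intro α hα β hβ γ hγ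
    rw [form_bracket_e_e_e ρ hα hβ hγ, form_bracket_e_e_e ρ hβ hγ hα,
      form_bracket_e_e_e ρ hγ hα hβ, show β + γ + α = α + β + γ by abel,
      show γ + α + β = α + β + γ by abel]
    split_ifs with h
    · have h' : β + γ + α = 0 := by rw [← h]; abel
      rw [eps_rotate hB hβ hγ hα h', eps_rotate hB hα hβ hγ h]
      exact ⟨rfl, rfl⟩
    · exact ⟨rfl, rfl⟩
  · intro α hα β hβ σ hσ v
    rw [bracket_e_e F B ρ hα hβ, bracket_e_proj F B ρ hσ hβ, bracket_proj_e F B ρ hσ hα]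
    simp only [map_smul, map_neg, map_add, LinearMap.smul_apply, LinearMap.neg_apply,
      LinearMap.add_apply, form_e_proj, form_proj_proj_apply ρ _ hσ, form_e_e_apply ρ _ hα,
      form_e_e_apply ρ _ hβ]
    rw [show β + σ + α = α + β + σ by abel, show α + σ + β = α + β + σ by abel]
    split_ifs with h
    · have h1 : α = -(β + σ) := eq_neg_of_add_eq_zero_left (by rw [← h]; abel)
      have h2 : bilC q v (toC α) = -bilC q v (toC β) := by
        rw [h1, toC_neg, toC_add, map_neg, map_add, bilC_of_mem_radC_right (toC_mem_radC hσ),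
          add_zero]
      have h3 : eps B α β = -eps B σ β := by
        rw [h1, eps_neg_left, eps_add_left, eps_self hB hβ, neg_one_mul]
      have h4 : eps B σ α = eps B σ β := by
        rw [h1, eps_neg_right, eps_add_right, eps_self_of_mem_rad hB hσ, mul_one]
      rw [bilC_comm q (toC α), h2, h3, h4]
      simp
    · simp
  · intro α hα β hβ ξ
    rw [bracket_e_e F B ρ hα hβ, bracket_e_inDual F B ρ hβ, bracket_inDual_e F B ρ hα]
    simp only [map_smul, map_neg, map_add, LinearMap.smul_apply, LinearMap.neg_apply,
      LinearMap.add_apply, form_e_inDual, form_proj_inDual, form_e_e_apply ρ _ hα,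
      form_e_e_apply ρ _ hβ, add_comm β α]
    split_ifs with h
    · rw [eq_neg_of_add_eq_zero_right h, eps_neg_right, eps_self hB hα, toC_neg, map_neg, map_neg]
      simp
    · simp
  · intro α hα σ hσ v τ hτ w
    rw [bracket_e_proj F B ρ hσ hα, bracket_proj_proj F B ρ hσ hτ, bracket_proj_e F B ρ hτ hα]
    simp [form_e_proj, form_proj_e]
  · intro α hα σ hσ v ξ
    rw [bracket_e_proj F B ρ hσ hα, bracket_proj_inDual F B ρ hσ, bracket_inDual_e F B ρ hα]
    simp [form_e_proj, form_proj_e, form_e_inDual]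
  · intro α hα ξ ζ
    rw [bracket_e_inDual F B ρ hα, bracket_inDual_inDual, bracket_inDual_e F B ρ hα]
    simp [form_e_inDual]
  · intro σ hσ v τ hτ w υ hυ u
    rw [bracket_proj_proj F B ρ hσ hτ, bracket_proj_proj F B ρ hτ hυ, bracket_proj_proj F B ρ hυ hσ]
    simp [form_proj_proj_apply ρ _ hσ, form_proj_proj_apply ρ _ hτ, form_proj_proj_apply ρ _ hυ,
      bilC_of_mem_radC_left (toC_mem_radC hσ), bilC_of_mem_radC_left (toC_mem_radC hτ),
      bilC_of_mem_radC_left (toC_mem_radC hυ)]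
  · intro σ hσ v τ hτ w ξ
    rw [bracket_proj_proj F B ρ hσ hτ, bracket_proj_inDual F B ρ hτ,
      bracket_inDual_proj F B ρ hσ]
    simp only [map_smul, map_neg, LinearMap.smul_apply, LinearMap.neg_apply, form_proj_inDual,
      form_proj_proj_apply ρ _ hσ, form_proj_proj_apply ρ _ hτ, add_comm τ σ]
    split_ifs with h
    · rw [eq_neg_of_add_eq_zero_right h, eps_neg_right, eps_self_of_mem_rad hB hσ, bilC_comm q w v,
        toC_neg, map_neg, map_neg]
      simp [mul_comm]
    · simp
  · intro σ hσ v ξ ζ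
    rw [bracket_proj_inDual F B ρ hσ, bracket_inDual_inDual, bracket_inDual_proj F B ρ hσ]
    simp only [map_smul, map_neg, LinearMap.smul_apply, LinearMap.neg_apply, form_proj_inDual]
    split_ifs with h
    · simp [h, toC_zero]
    · simp
  · intro ξ ζ η
    simp [bracket_inDual_inDual]

theorem form_bracket_invariant (hF : ∀ σ : rad q, toC (σ : Fin n → ℤ) ∈ F.W σ)
    (hq : IsNonneg q) (hB : ∀ x, B x x = q x) (x y z : Alg F) :
    form F ρ (bracket F B ρ x y) z = form F ρ x (bracket F B ρ y z) := by
  rw [form_bracket_rotate ρ hF hq hB, form_symm]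

end

section

variable {F : RadFamily q}
  {B : LinearMap.BilinForm ℤ (Fin n → ℤ)} {ρ : (Fin n → ℂ) →ₗ[ℂ] radC q}

/-! ### Coordinates and non-degeneracy -/

/-- The coordinate of degree `σ` in the summand `ℂⁿ/W_σ`. -/
def coordP (F : RadFamily q) (σ : rad q) : Alg F →ₗ[ℂ] ((Fin n → ℂ) ⧸ F.W σ) :=
  DirectSum.component ℂ (rad q) (fun σ => (Fin n → ℂ) ⧸ F.W σ) σ ∘ₗ sndP F

/-- The coefficient of `e_α`. -/
def coordE (F : RadFamily q) (α : {α : Fin n → ℤ // q α = 1}) : Alg F →ₗ[ℂ] ℂ :=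
  Finsupp.lapply α ∘ₗ fstE F

theorem coordE_e (α : {α : Fin n → ℤ // q α = 1}) {β : Fin n → ℤ} (hβ : q β = 1) :
    coordE F α (e F β) = if β = α then 1 else 0 := by
  classical
  simp [coordE, e_of F hβ, Finsupp.single_apply, Subtype.ext_iff]

theorem coordE_proj (α : {α : Fin n → ℤ // q α = 1}) (σ : Fin n → ℤ) (v : Fin n → ℂ) :
    coordE F α (proj F σ v) = 0 := by
  unfold proj
  split_ifs <;> simp [coordE]

theorem coordE_inDual (α : {α : Fin n → ℤ // q α = 1}) (ξ : Module.Dual ℂ (radC q)) :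
    coordE F α (inDual F ξ) = 0 := by
  simp [coordE]

theorem coordP_e (σ : rad q) (β : Fin n → ℤ) : coordP F σ (e F β) = 0 := by
  unfold e
  split_ifs <;> simp [coordP]

theorem coordP_proj_self {σ : Fin n → ℤ} (hσ : σ ∈ rad q) (v : Fin n → ℂ) :
    coordP F ⟨σ, hσ⟩ (proj F σ v) = Submodule.Quotient.mk v := by
  simp [coordP, proj_of F hσ, DirectSum.component.lof_self]

theorem coordP_proj_zero (v : Fin n → ℂ) :
    coordP F 0 (proj F 0 v) = Submodule.Quotient.mk v :=
  coordP_proj_self (zero_mem _) v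

theorem coordP_proj_of_ne (σ : rad q) {τ : Fin n → ℤ} (h : τ ≠ σ) (v : Fin n → ℂ) :
    coordP F σ (proj F τ v) = 0 := by
  classical
  by_cases hτ : τ ∈ rad q
  · have : (⟨τ, hτ⟩ : rad q) ≠ σ := fun h' => h (congrArg Subtype.val h')
    simp only [coordP, proj_of F hτ, LinearMap.comp_apply, sndP_inP]
    rw [DirectSum.component.of, dif_neg this]
  · rw [proj_ne F hτ, map_zero]

theorem coordP_inDual (σ : rad q) (ξ : Module.Dual ℂ (radC q)) :
    coordP F σ (inDual F ξ) = 0 := by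
  simp [coordP]

theorem trdX_e (β : Fin n → ℤ) : trdX F (e F β) = 0 := by
  unfold e
  split_ifs <;> simp

theorem trdX_proj (σ : Fin n → ℤ) (v : Fin n → ℂ) : trdX F (proj F σ v) = 0 := by
  unfold proj
  split_ifs <;> simp

theorem alg_ext {x y : Alg F} (hE : ∀ α, coordE F α x = coordE F α y)
    (hP : ∀ σ, coordP F σ x = coordP F σ y) (hX : trdX F x = trdX F y) : x = y :=
  Prod.ext (Finsupp.ext hE) (Prod.ext (DirectSum.ext_component ℂ hP) hX)

theorem form_e_right (x : Alg F) {β : Fin n → ℤ} (hβ : q β = 1) :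
    form F ρ x (e F β) = -coordE F ⟨-β, by rwa [QuadraticMap.map_neg]⟩ x := by
  have : form F ρ (e F β) = -coordE F ⟨-β, by rwa [QuadraticMap.map_neg]⟩ := by
    refine alg_hom_ext _ (fun α hα => ?_) (fun σ hσ v => ?_) fun ξ => ?_ <;>
      rw [LinearMap.neg_apply]
    · rw [form_e_e ρ hβ hα, coordE_e _ hα, add_comm]
      simp only [eq_neg_iff_add_eq_zero]
      split_ifs <;> simp
    · rw [form_e_proj, coordE_proj, neg_zero]
    · rw [form_e_inDual, coordE_inDual, neg_zero]
  rw [form_symm, this, LinearMap.neg_apply]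

theorem form_proj_right (x : Alg F) (σ : rad q) {τ : Fin n → ℤ} (hτ : (σ : Fin n → ℤ) + τ = 0)
    (w : Fin n → ℂ) : form F ρ x (proj F τ w) =
      pairL F σ w (coordP F σ x) + if τ = 0 then trdX F x (ρ w) else 0 := by
  obtain rfl := eq_neg_of_add_eq_zero_right hτ
  have : form F ρ (proj F (-σ : Fin n → ℤ) w) = pairL F σ w ∘ₗ coordP F σ +
      if (-σ : Fin n → ℤ) = 0 then Module.Dual.eval ℂ (radC q) (ρ w) ∘ₗ trdX F else 0 := by
    refine alg_hom_ext _ (fun α hα => ?_) (fun υ hυ v => ?_) fun ξ => ?_ <;>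
      rw [LinearMap.add_apply, LinearMap.comp_apply]
    · rw [form_proj_e, coordP_e]
      split_ifs <;> simp [trdX_e]
    · rw [form_proj_proj ρ (neg_mem σ.2) hυ]
      have h0 : (if (-σ : Fin n → ℤ) = 0 then Module.Dual.eval ℂ (radC q) (ρ w) ∘ₗ trdX F else 0)
          (proj F υ v) = 0 := by
        split_ifs <;> simp [trdX_proj]
      rw [h0, add_zero]
      split_ifs with h
      · obtain rfl : υ = σ := (neg_add_eq_zero.1 h).symm
        rw [coordP_proj_self σ.2, pairL_mk, bilC_comm]
      · rw [coordP_proj_of_ne, map_zero]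
        rintro rfl
        exact h (neg_add_cancel _)
    · rw [form_proj_inDual, coordP_inDual]
      split_ifs <;> simp
  rw [form_symm, this, LinearMap.add_apply]
  split_ifs <;> rfl

theorem form_inDual_right (x : Alg F) (ξ : Module.Dual ℂ (radC q)) {v : Fin n → ℂ}
    (hv : coordP F 0 x = Submodule.Quotient.mk v) :
    form F ρ x (inDual F ξ) = ξ (ρ v) := by
  have : form F ρ (inDual F ξ) =
      (F.W 0).liftQ (ξ ∘ₗ ρ) (by rw [F.zero]; exact bot_le) ∘ₗ coordP F 0 := by
    refine alg_hom_ext _ (fun α hα => ?_) (fun σ hσ v => ?_) fun ξ => ?_ <;>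
      rw [LinearMap.comp_apply]
    · rw [form_inDual_e, coordP_e, map_zero]
    · rw [form_inDual_proj ρ hσ]
      split_ifs with h
      · subst h
        rw [coordP_proj_zero]
        rfl
      · rw [coordP_proj_of_ne _ h, map_zero]
    · rw [form_inDual_inDual, coordP_inDual, map_zero]
  rw [form_symm, this, LinearMap.comp_apply, hv]
  rfl

/-- The joint kernel of `u ↦ q(u, -)` and `ρ` vanishes: it lies in `rad_ℂ q`, where `ρ` is the
identity. -/
theorem eq_zero_of_bilC_of_dual (hρ : ∀ v : radC q, ρ (v : Fin n → ℂ) = v) {u : Fin n → ℂ}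
    (h1 : ∀ v, bilC q u v = 0) (h2 : ∀ ξ : Module.Dual ℂ (radC q), ξ (ρ u) = 0) : u = 0 := by
  have h3 := hρ ⟨u, mem_radC_of_bilC h1⟩
  rw [(Module.forall_dual_apply_eq_zero_iff ℂ _).1 h2] at h3
  exact (congrArg Subtype.val h3).symm

/-- The form is non-degenerate on `ℂⁿ ⊕ (rad_ℂ q)^*`. -/
theorem eq_zero_of_form_degree_zero (hρ : ∀ v : radC q, ρ (v : Fin n → ℂ) = v) {x : Alg F}
    (h1 : ∀ w, form F ρ x (proj F 0 w) = 0) (h2 : ∀ ξ, form F ρ x (inDual F ξ) = 0) :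
    coordP F 0 x = 0 ∧ trdX F x = 0 := by
  obtain ⟨v, hv⟩ := Submodule.Quotient.mk_surjective _ (coordP F 0 x)
  have h1' : ∀ w, bilC q v w + trdX F x (ρ w) = 0 := by
    intro w
    rw [← h1 w, form_proj_right x 0 (add_zero _), if_pos rfl, ← hv, pairL_mk]
  have hX : trdX F x = 0 := by
    ext w
    have h := h1' w
    rwa [bilC_of_mem_radC_right w.2, zero_add, hρ] at h
  refine ⟨?_, hX⟩
  have hv0 : v = 0 := by
    refine eq_zero_of_bilC_of_dual hρ (fun w => ?_) fun ξ => ?_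
    · simpa [hX] using h1' w
    · rw [← form_inDual_right x ξ hv.symm, h2]
  rw [← hv, hv0, Submodule.Quotient.mk_zero]

theorem famE_W_of_ne {σ : rad q} (h : σ ≠ 0) : (famE q).W σ = radC q := if_neg h

theorem toC_mem_famE (σ : rad q) : toC (σ : Fin n → ℤ) ∈ (famE q).W σ := by
  by_cases h : σ = 0
  · subst h
    simp [toC_zero]
  · rw [famE_W_of_ne h]
    exact toC_mem_radC σ.2

theorem form_separating (hρ : ∀ v : radC q, ρ (v : Fin n → ℂ) = v) {x : E q}
    (hx : ∀ y, form (famE q) ρ x y = 0) : x = 0 := by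
  obtain ⟨h0, hX⟩ := eq_zero_of_form_degree_zero hρ (fun w => hx (proj _ 0 w))
    fun ξ => hx (inDual _ ξ)
  refine alg_ext (fun α => ?_) (fun σ => ?_) ?_
  · have hα : q (-α : Fin n → ℤ) = 1 := by rw [QuadraticMap.map_neg, α.2]
    have h := hx (e _ (-α : Fin n → ℤ))
    rw [form_e_right x hα, neg_eq_zero] at h
    simpa using h
  · rw [map_zero]
    by_cases hσ : σ = 0
    · rw [hσ, h0]
    obtain ⟨v, hv⟩ := Submodule.Quotient.mk_surjective _ (coordP (famE q) σ x)
    rw [← hv, Submodule.Quotient.mk_eq_zero, famE_W_of_ne hσ]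
    refine mem_radC_of_bilC fun w => ?_
    have hσ' : (-σ : Fin n → ℤ) ≠ 0 := by simpa using hσ
    rw [← hx (proj _ (-σ : Fin n → ℤ) w), form_proj_right x σ (add_neg_cancel _), if_neg hσ',
      add_zero, ← hv, pairL_mk]
  · rw [hX, map_zero]

/-! ### Weights and root spaces -/

theorem mem_component_zero {x : Alg F} :
    x ∈ component F 0 ↔ ∃ v ξ, x = proj F 0 v + inDual F ξ := by
  simp [component, Submodule.mem_sup, eq_comm]

theorem proj_mem_component_zero (v : Fin n → ℂ) : proj F 0 v ∈ component F 0 :=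
  mem_component_zero.2 ⟨v, 0, by simp⟩

theorem inDual_mem_component_zero (ξ : Module.Dual ℂ (radC q)) :
    inDual F ξ ∈ component F 0 :=
  mem_component_zero.2 ⟨0, ξ, by simp⟩

/-- The functional `weight α` is represented by `π_0(α)` with respect to the form. -/
theorem weight_eq_form (α : Fin n → ℤ) : weight F ρ α = form F ρ (proj F 0 (toC α)) := by
  refine alg_hom_ext _ (fun β hβ => ?_) (fun σ hσ v => ?_) fun ξ => ?_ <;>
    rw [weight, LinearMap.add_apply] <;>
    change pairL F 0 (toC α) (coordP F 0 _) + _ = _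
  · rw [coordP_e, form_proj_e]
    simp [trdX_e]
  · rw [form_proj_proj ρ (zero_mem _) hσ, zero_add]
    simp only [LinearMap.comp_apply, trdX_proj, map_zero, add_zero]
    split_ifs with h
    · subst h
      rw [coordP_proj_zero, pairL_mk, bilC_comm]
    · rw [coordP_proj_of_ne _ h, map_zero]
  · rw [coordP_inDual, form_proj_inDual]
    simp

theorem weight_proj_zero (α : Fin n → ℤ) (v : Fin n → ℂ) :
    weight F ρ α (proj F 0 v) = bilC q v (toC α) := by
  rw [weight_eq_form, form_proj_proj ρ (zero_mem _) (zero_mem _), if_pos (zero_add 0), bilC_comm]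

theorem weight_inDual (α : Fin n → ℤ) (ξ : Module.Dual ℂ (radC q)) :
    weight F ρ α (inDual F ξ) = ξ (ρ (toC α)) := by
  rw [weight_eq_form, form_proj_inDual, if_pos rfl]

theorem bracket_degree_zero_e {h : Alg F} (hh : h ∈ component F 0) (β : Fin n → ℤ) :
    bracket F B ρ h (e F β) = weight F ρ β h • e F β := by
  obtain ⟨v, ξ, rfl⟩ := mem_component_zero.1 hh
  rw [map_add, map_add, LinearMap.add_apply, bracket_inDual_e_apply,
    bracket_proj_e_apply F ρ (zero_mem _), weight_proj_zero, weight_inDual, eps_zero_left, one_mul,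
    add_zero, add_smul]

theorem bracket_degree_zero_proj {h : Alg F} (hh : h ∈ component F 0) {τ : Fin n → ℤ}
    (hτ : τ ∈ rad q) (w : Fin n → ℂ) :
    bracket F B ρ h (proj F τ w) = weight F ρ τ h • proj F τ w := by
  obtain ⟨v, ξ, rfl⟩ := mem_component_zero.1 hh
  rw [map_add, map_add, LinearMap.add_apply, bracket_inDual_proj_apply,
    bracket_proj_proj F B ρ (zero_mem _) hτ, weight_proj_zero, weight_inDual, toC_zero, map_zero,
    smul_zero, bilC_of_mem_radC_right (toC_mem_radC hτ), zero_add, zero_add]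

theorem bracket_degree_zero_inDual {h : Alg F} (hh : h ∈ component F 0)
    (ζ : Module.Dual ℂ (radC q)) : bracket F B ρ h (inDual F ζ) = 0 := by
  obtain ⟨v, ξ, rfl⟩ := mem_component_zero.1 hh
  rw [map_add, LinearMap.add_apply, bracket_inDual_inDual,
    bracket_proj_inDual F B ρ (zero_mem _), toC_zero]
  simp

theorem coordE_bracket {h : Alg F} (hh : h ∈ component F 0) (x : Alg F)
    (α : {α : Fin n → ℤ // q α = 1}) :
    coordE F α (bracket F B ρ h x) = weight F ρ α h * coordE F α x := by
  have : coordE F α ∘ₗ bracket F B ρ h = weight F ρ α h • coordE F α := by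
    refine alg_hom_ext _ (fun β hβ => ?_) (fun σ hσ v => ?_) fun ξ => ?_ <;>
      simp only [LinearMap.comp_apply, LinearMap.smul_apply]
    · rw [bracket_degree_zero_e hh, map_smul, coordE_e _ hβ]
      split_ifs with h
      · rw [h]
      · simp
    · rw [bracket_degree_zero_proj hh hσ, map_smul, coordE_proj, smul_zero, smul_zero]
    · rw [bracket_degree_zero_inDual hh, coordE_inDual, map_zero, smul_zero]
  exact LinearMap.congr_fun this x

theorem coordP_bracket {h : Alg F} (hh : h ∈ component F 0) (x : Alg F) (σ : rad q) :
    coordP F σ (bracket F B ρ h x) = weight F ρ σ h • coordP F σ x := by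
  have : coordP F σ ∘ₗ bracket F B ρ h = weight F ρ σ h • coordP F σ := by
    refine alg_hom_ext _ (fun β hβ => ?_) (fun τ hτ v => ?_) fun ξ => ?_ <;>
      simp only [LinearMap.comp_apply, LinearMap.smul_apply]
    · rw [bracket_degree_zero_e hh, map_smul, coordP_e, smul_zero, smul_zero]
    · rw [bracket_degree_zero_proj hh hτ, map_smul]
      by_cases h : τ = σ
      · rw [h]
      · rw [coordP_proj_of_ne _ h, smul_zero, smul_zero]
    · rw [bracket_degree_zero_inDual hh, coordP_inDual, map_zero, smul_zero]
  exact LinearMap.congr_fun this x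

theorem trdX_bracket {h : Alg F} (hh : h ∈ component F 0) (x : Alg F) :
    trdX F (bracket F B ρ h x) = 0 := by
  have : trdX F ∘ₗ bracket F B ρ h = 0 := by
    refine alg_hom_ext _ (fun β hβ => ?_) (fun τ hτ v => ?_) fun ξ => ?_ <;>
      simp only [LinearMap.comp_apply, LinearMap.zero_apply]
    · rw [bracket_degree_zero_e hh, map_smul, trdX_e, smul_zero]
    · rw [bracket_degree_zero_proj hh hτ, map_smul, trdX_proj, smul_zero]
    · rw [bracket_degree_zero_inDual hh, map_zero]
  exact LinearMap.congr_fun this x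

end

section

variable {F : RadFamily q}
  {B : LinearMap.BilinForm ℤ (Fin n → ℤ)} {ρ : (Fin n → ℂ) →ₗ[ℂ] radC q}

theorem ne_zero_of_map_eq_one {α : Fin n → ℤ} (hα : q α = 1) : α ≠ 0 := by
  rintro rfl
  simp at hα

theorem e_mem_component (α : Fin n → ℤ) : e F α ∈ component F α := by
  by_cases h : q α = 1
  · rw [component, if_neg (ne_zero_of_map_eq_one h), if_pos h]
    exact Submodule.mem_span_singleton_self _
  · rw [e_ne F h]
    exact zero_mem _

theorem proj_mem_component (σ : Fin n → ℤ) (v : Fin n → ℂ) : proj F σ v ∈ component F σ := by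
  by_cases h0 : σ = 0
  · rw [h0]
    exact proj_mem_component_zero v
  by_cases h1 : q σ = 1
  · rw [proj_ne F (not_mem_rad_of_map_ne (by rw [h1]; exact one_ne_zero))]
    exact zero_mem _
  · rw [component, if_neg h0, if_neg h1]
    exact ⟨v, rfl⟩

/-- Case distinction for homogeneous elements. -/
theorem mem_component_cases {α : Fin n → ℤ} {x : Alg F} (hx : x ∈ component F α) :
    (α = 0 ∧ ∃ v ξ, x = proj F 0 v + inDual F ξ) ∨ (q α = 1 ∧ ∃ c : ℂ, x = c • e F α) ∨
      (α ∈ rad q ∧ ∃ v, x = proj F α v) ∨ x = 0 := by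
  by_cases h0 : α = 0
  · subst h0
    exact Or.inl ⟨rfl, mem_component_zero.1 hx⟩
  rw [component, if_neg h0] at hx
  split_ifs at hx with h1
  · obtain ⟨c, rfl⟩ := Submodule.mem_span_singleton.1 hx
    exact Or.inr (Or.inl ⟨h1, c, rfl⟩)
  · obtain ⟨v, rfl⟩ := hx
    by_cases h : α ∈ rad q
    · exact Or.inr (Or.inr (Or.inl ⟨h, v, rfl⟩))
    · exact Or.inr (Or.inr (Or.inr (proj_ne F h v)))

theorem component_eq_bot {α : Fin n → ℤ} (hα : α ∉ rootSet q) :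
    component F α = ⊥ := by
  refine (Submodule.eq_bot_iff _).2 fun x hx => ?_
  have h0 : q α ≠ 0 := fun h => hα (Or.inl h)
  have h1 : q α ≠ 1 := fun h => hα (Or.inr h)
  rcases mem_component_cases hx with ⟨rfl, -⟩ | ⟨h, -⟩ | ⟨h, -⟩ | h
  · simp at h0
  · exact absurd h h1
  · exact absurd (map_of_mem_rad h) h0
  · exact h

theorem proj_single_ne_zero (hu : IsUnitForm q) (i : Fin n) {σ : Fin n → ℤ} (hσ : σ ∈ rad q) :
    proj F σ (toC (Pi.single i 1)) ≠ 0 := by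
  intro h
  have h' := congrArg (coordP F ⟨σ, hσ⟩) h
  rw [coordP_proj_self hσ, map_zero, Submodule.Quotient.mk_eq_zero] at h'
  have h2 := bilC_of_mem_radC_left (F.le _ h') (toC (Pi.single i 1))
  rw [bilC_toC, polar_self_eq, map_single hu] at h2
  norm_num at h2

theorem component_ne_bot (hq : IsNonneg q) (hu : IsUnitForm q) (i : Fin n) {α : Fin n → ℤ}
    (hα : α ∈ rootSet q) : component F α ≠ ⊥ := by
  intro h
  rcases hα with h0 | h1
  · have hr : α ∈ rad q := (mem_rad_iff hq).2 h0
    refine proj_single_ne_zero (F := F) hu i hr ?_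
    rw [← Submodule.mem_bot ℂ, ← h]
    exact proj_mem_component _ _
  · have h' : e F α ∈ component F α := e_mem_component α
    rw [h, Submodule.mem_bot] at h'
    have h2 := congrArg (coordE F ⟨α, h1⟩) h'
    rw [coordE_e _ h1] at h2
    simp at h2

theorem weight_zero : weight F ρ 0 = 0 := by
  rw [weight_eq_form, toC_zero, map_zero, map_zero]

theorem bracket_of_mem_component {α : Fin n → ℤ} {h x : Alg F} (hh : h ∈ component F 0)
    (hx : x ∈ component F α) : bracket F B ρ h x = weight F ρ α h • x := by
  rcases mem_component_cases hx with ⟨rfl, v, ξ, rfl⟩ | ⟨-, c, rfl⟩ | ⟨hα, v, rfl⟩ | rfl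
  · rw [map_add, bracket_degree_zero_proj hh (zero_mem _), bracket_degree_zero_inDual hh,
      weight_zero]
    simp
  · rw [map_smul, bracket_degree_zero_e hh, smul_comm]
  · rw [bracket_degree_zero_proj hh hα]
  · rw [map_zero, smul_zero]

/-- Already the restrictions to `E_0` of the weights determine the degree. -/
theorem eq_of_weight_eq (hρ : ∀ v : radC q, ρ (v : Fin n → ℂ) = v) {α β : Fin n → ℤ}
    (h : ∀ x ∈ component F 0, weight F ρ α x = weight F ρ β x) : α = β := by
  refine toC_injective (sub_eq_zero.1 (eq_zero_of_bilC_of_dual hρ (fun v => ?_) fun ξ => ?_))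
  · have := h _ (proj_mem_component_zero v)
    rw [weight_proj_zero, weight_proj_zero] at this
    rw [bilC_comm, map_sub, this, sub_self]
  · have := h _ (inDual_mem_component_zero ξ)
    rw [weight_inDual, weight_inDual] at this
    rw [map_sub, map_sub, this, sub_self]

theorem eq_weight_of_coordE_ne_zero {b : Alg F → ℂ} {x : Alg F}
    (hx : ∀ h ∈ component F 0, bracket F B ρ h x = b h • x)
    {α : {α : Fin n → ℤ // q α = 1}} (h0 : coordE F α x ≠ 0)
    {h : Alg F} (hh : h ∈ component F 0) : b h = weight F ρ α h := by
  have := congrArg (coordE F α) (hx h hh)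
  rw [coordE_bracket hh, map_smul, smul_eq_mul] at this
  exact (mul_right_cancel₀ h0 this).symm

theorem eq_weight_of_coordP_ne_zero {b : Alg F → ℂ} {x : Alg F}
    (hx : ∀ h ∈ component F 0, bracket F B ρ h x = b h • x)
    {σ : rad q} (h0 : coordP F σ x ≠ 0)
    {h : Alg F} (hh : h ∈ component F 0) : b h = weight F ρ σ h := by
  have := congrArg (coordP F σ) (hx h hh)
  rw [coordP_bracket hh, map_smul] at this
  exact (smul_left_injective ℂ h0 this).symm

theorem eq_weight_of_trdX_ne_zero {b : Alg F → ℂ} {x : Alg F}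
    (hx : ∀ h ∈ component F 0, bracket F B ρ h x = b h • x)
    (h0 : trdX F x ≠ 0)
    {h : Alg F} (hh : h ∈ component F 0) : b h = weight F ρ 0 h := by
  have := congrArg (trdX F) (hx h hh)
  rw [trdX_bracket hh, map_smul] at this
  rw [weight_zero, LinearMap.zero_apply]
  exact (smul_eq_zero.1 this.symm).resolve_right h0

/-- The weight of a common eigenvector of `E_0` is that of a root of `q`. -/
theorem exists_root_of_eigenvector {b : Alg F → ℂ} {x : Alg F}
    (hx : ∀ h ∈ component F 0, bracket F B ρ h x = b h • x)
    (h0 : x ≠ 0) :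
    ∃ α ∈ rootSet q, ∀ h ∈ component F 0, b h = weight F ρ α h := by
  by_contra! hn
  refine h0 (alg_ext (fun α => ?_) (fun σ => ?_) ?_)
  · rw [map_zero]
    by_contra h
    obtain ⟨y, hy, hy'⟩ := hn α (Or.inr α.2)
    exact hy' (eq_weight_of_coordE_ne_zero hx h hy)
  · rw [map_zero]
    by_contra h
    obtain ⟨y, hy, hy'⟩ := hn σ (Or.inl (map_of_mem_rad σ.2))
    exact hy' (eq_weight_of_coordP_ne_zero hx h hy)
  · rw [map_zero]
    by_contra h
    obtain ⟨y, hy, hy'⟩ := hn 0 (Or.inl (map_zero q))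
    exact hy' (eq_weight_of_trdX_ne_zero hx h hy)

/-- The homogeneous component of degree `α` is the simultaneous eigenspace of `E_0` of weight
`α`, since different elements of `ℤⁿ` have different weights. -/
theorem mem_component_iff (hρ : ∀ v : radC q, ρ (v : Fin n → ℂ) = v) {α : Fin n → ℤ}
    {x : Alg F} : x ∈ component F α ↔
      ∀ h ∈ component F 0, bracket F B ρ h x = weight F ρ α h • x := by
  refine ⟨fun hx h hh => bracket_of_mem_component hh hx, fun hx => ?_⟩
  have hE : ∀ β : {β : Fin n → ℤ // q β = 1}, (β : Fin n → ℤ) ≠ α → coordE F β x = 0 := by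
    intro β hβ
    by_contra h
    exact hβ (eq_of_weight_eq hρ fun y hy => (eq_weight_of_coordE_ne_zero hx h hy).symm)
  have hP : ∀ σ : rad q, (σ : Fin n → ℤ) ≠ α → coordP F σ x = 0 := by
    intro σ hσ
    by_contra h
    exact hσ (eq_of_weight_eq hρ fun y hy => (eq_weight_of_coordP_ne_zero hx h hy).symm)
  have hX : α ≠ 0 → trdX F x = 0 := by
    intro hα
    by_contra h
    exact hα (eq_of_weight_eq hρ fun y hy => eq_weight_of_trdX_ne_zero hx h hy)
  by_cases h0 : α = 0
  · subst h0
    obtain ⟨v, hv⟩ := Submodule.Quotient.mk_surjective _ (coordP F 0 x)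
    refine mem_component_zero.2 ⟨v, trdX F x, alg_ext (fun β => ?_) (fun σ => ?_) ?_⟩
    · rw [hE β (ne_zero_of_map_eq_one β.2), map_add, coordE_proj, coordE_inDual, add_zero]
    · rw [map_add, coordP_inDual, add_zero]
      by_cases h : σ = 0
      · rw [h, coordP_proj_zero, hv]
      · have h' : (σ : Fin n → ℤ) ≠ 0 := by simpa using h
        rw [hP σ h', coordP_proj_of_ne _ h'.symm]
    · rw [map_add, trdX_proj, zero_add, trdX_inDual]
  by_cases h1 : q α = 1
  · have : x = coordE F ⟨α, h1⟩ x • e F α := by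
      refine alg_ext (fun β => ?_) (fun σ => ?_) ?_
      · rw [map_smul, coordE_e _ h1]
        by_cases h : (β : Fin n → ℤ) = α
        · obtain rfl : β = ⟨α, h1⟩ := Subtype.ext h
          simp
        · rw [hE β h, if_neg fun h' => h h'.symm, smul_zero]
      · rw [map_smul, coordP_e, smul_zero]
        refine hP σ ?_
        rintro rfl
        rw [map_of_mem_rad σ.2] at h1
        exact zero_ne_one h1
      · rw [map_smul, trdX_e, smul_zero, hX h0]
    rw [this]
    exact Submodule.smul_mem _ _ (e_mem_component α)
  have hE' : ∀ β, coordE F β x = 0 := by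
    refine fun β => hE β ?_
    rintro rfl
    exact h1 β.2
  by_cases hr : α ∈ rad q
  · obtain ⟨v, hv⟩ := Submodule.Quotient.mk_surjective _ (coordP F ⟨α, hr⟩ x)
    have : x = proj F α v := by
      refine alg_ext (fun β => ?_) (fun σ => ?_) ?_
      · rw [coordE_proj, hE']
      · by_cases h : (σ : Fin n → ℤ) = α
        · obtain rfl : σ = ⟨α, hr⟩ := Subtype.ext h
          rw [← hv, coordP_proj_self]
        · rw [hP σ h, coordP_proj_of_ne _ fun h' => h h'.symm]
      · rw [trdX_proj, hX h0]
    rw [this]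
    exact proj_mem_component _ _
  · have : x = 0 := by
      refine alg_ext (fun β => ?_) (fun σ => ?_) ?_
      · rw [hE', map_zero]
      · rw [map_zero]
        refine hP σ ?_
        rintro rfl
        exact hr σ.2
      · rw [map_zero, hX h0]
    rw [this]
    exact zero_mem _

/-! ### Nilpotency and diagonalizability -/

theorem bracket_e_mem_component {α β : Fin n → ℤ} (hα : q α = 1) {x : Alg F}
    (hx : x ∈ component F β) : bracket F B ρ (e F α) x ∈ component F (α + β) := by
  rcases mem_component_cases hx with ⟨rfl, v, ξ, rfl⟩ | ⟨hβ, c, rfl⟩ | ⟨hβ, v, rfl⟩ | rfl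
  · rw [map_add, bracket_e_proj F B ρ (zero_mem _) hα, bracket_e_inDual F B ρ hα]
    refine add_mem (neg_mem (Submodule.smul_mem _ _ (e_mem_component _)))
      (neg_mem (Submodule.smul_mem _ _ ?_))
    rw [add_zero]
    exact e_mem_component _
  · rw [map_smul, bracket_e_e F B ρ hα hβ]
    exact Submodule.smul_mem _ _ (Submodule.smul_mem _ _
      (add_mem (e_mem_component _) (proj_mem_component _ _)))
  · rw [bracket_e_proj F B ρ hβ hα]
    exact neg_mem (Submodule.smul_mem _ _ (e_mem_component _))
  · rw [map_zero]
    exact zero_mem _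

/-- `(ad e_α)³ = 0`: for a root `β` of `q` the value
`q(β + 3α) = q(β) + 3 q(α, β) + 9` is at least `3`, so `β + 3α` is not a root. -/
theorem bracket_e_cube (hq : IsNonneg q) {α : Fin n → ℤ} (hα : q α = 1) (y : Alg F) :
    bracket F B ρ (e F α) (bracket F B ρ (e F α) (bracket F B ρ (e F α) y)) = 0 := by
  have key : ∀ β ∈ rootSet q, ∀ y ∈ component F β,
      bracket F B ρ (e F α) (bracket F B ρ (e F α) (bracket F B ρ (e F α) y)) = 0 := by
    intro β hβ y hy
    have h := bracket_e_mem_component (B := B) (ρ := ρ) hα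
      (bracket_e_mem_component (B := B) (ρ := ρ) hα
        (bracket_e_mem_component (B := B) (ρ := ρ) hα hy))
    rwa [component_eq_bot, Submodule.mem_bot] at h
    have h3 : q (α + (α + (α + β))) = 9 + q β + 3 * QuadraticMap.polar q α β := by
      simp only [map_add_eq, QuadraticMap.polar_add_right, polar_self_eq, hα]
      ring
    have hpol : -2 ≤ QuadraticMap.polar q α β := by
      rcases hβ with h0 | h1
      · rw [polar_of_mem_rad_right ((mem_rad_iff hq).2 h0)]
        norm_num
      · exact neg_two_le_polar hq hα h1
    have hβ' := hq β
    rintro (h0 | h1)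
    · have h0' : q (α + (α + (α + β))) = 0 := h0
      omega
    · have h1' : q (α + (α + (α + β))) = 1 := h1
      omega
  refine alg_induction (p := fun y => bracket F B ρ (e F α) (bracket F B ρ (e F α)
    (bracket F B ρ (e F α) y)) = 0) (fun β hβ => key β (Or.inr hβ) _ (e_mem_component β))
    (fun σ hσ v => key σ (Or.inl (map_of_mem_rad hσ)) _ (proj_mem_component σ v))
    (fun ξ => key 0 (Or.inl (map_zero q)) _ (inDual_mem_component_zero ξ)) ?_ ?_ y
  · intro x y hx hy
    simp only [map_add, hx, hy, add_zero]
  · intro c x hx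
    simp only [map_smul, hx, smul_zero]

theorem bracket_component_cube (hq : IsNonneg q) {α : Fin n → ℤ} (hα : q α = 1) {x : Alg F}
    (hx : x ∈ component F α) (y : Alg F) :
    bracket F B ρ x (bracket F B ρ x (bracket F B ρ x y)) = 0 := by
  rw [component, if_neg (ne_zero_of_map_eq_one hα), if_pos hα] at hx
  obtain ⟨c, rfl⟩ := Submodule.mem_span_singleton.1 hx
  simp only [map_smul, LinearMap.smul_apply, bracket_e_cube hq hα, smul_zero]

theorem iSup_eigenspace_eq_top {h : Alg F} (hh : h ∈ component F 0) :
    ⨆ c : ℂ, Module.End.eigenspace (bracket F B ρ h : Module.End ℂ (Alg F)) c = ⊤ := by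
  refine eq_top_iff.2 fun x _ => ?_
  refine alg_induction (fun β hβ => ?_) (fun σ hσ v => ?_) (fun ξ => ?_)
    (fun x y => Submodule.add_mem _) (fun c x => Submodule.smul_mem _ c) x
  · refine Submodule.mem_iSup_of_mem (weight F ρ β h) (Module.End.mem_eigenspace_iff.2 ?_)
    exact bracket_degree_zero_e hh β
  · refine Submodule.mem_iSup_of_mem (weight F ρ σ h) (Module.End.mem_eigenspace_iff.2 ?_)
    exact bracket_degree_zero_proj hh hσ v
  · refine Submodule.mem_iSup_of_mem 0 (Module.End.mem_eigenspace_iff.2 ?_)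
    rw [zero_smul]
    exact bracket_degree_zero_inDual hh ξ

/-! ### The lattice of weights -/

theorem isEmbedding_toC : Topology.IsEmbedding (toC : (Fin n → ℤ) → Fin n → ℂ) := by
  have h : Topology.IsEmbedding (fun z : ℤ => (z : ℂ)) := by
    have := Complex.isometry_ofReal.isEmbedding.comp Int.isClosedEmbedding_coe_real.isEmbedding
    simpa [Function.comp_def] using this
  exact Topology.IsEmbedding.piMap fun _ => h

/-- An injective linear map from `ℂⁿ` sends sets of integral vectors to discrete sets. -/
theorem isDiscrete_image_toC {V : Type*} [AddCommGroup V] [Module ℂ V]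
    {f : (Fin n → ℂ) →ₗ[ℂ] V} (hf : Function.Injective f) (S : Set (Fin n → ℤ)) :
    @IsDiscrete V (moduleTopology ℂ V) ((fun α => f (toC α)) '' S) := by
  let _ : TopologicalSpace V := moduleTopology ℂ V
  have : IsModuleTopology ℂ V := ⟨rfl⟩
  obtain ⟨g, hg⟩ := f.exists_leftInverse_of_injective (LinearMap.ker_eq_bot.2 hf)
  have hgf : ∀ u, g (f u) = u := fun u => LinearMap.congr_fun hg u
  have hgc : Continuous g := IsModuleTopology.continuous_of_linearMap g
  choose! r hr using fun (x : V) (hx : x ∈ (fun α => f (toC α)) '' S) => hx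
  have hr' : ∀ x : ((fun α => f (toC α)) '' S : Set V), toC (r x) = g x := by
    intro x
    have := congrArg g (hr x x.2).2
    rwa [hgf] at this
  refine ⟨DiscreteTopology.of_continuous_injective
    (f := fun x : ((fun α => f (toC α)) '' S : Set V) => r x) ?_ ?_⟩
  · rw [isEmbedding_toC.continuous_iff]
    refine (continuous_congr hr').2 ?_
    exact hgc.comp continuous_subtype_val
  · intro x y hxy
    refine Subtype.ext ?_
    rw [← (hr x x.2).2, ← (hr y y.2).2]
    exact congrArg (fun α => f (toC α)) hxy

/-- A `ℤ`-basis of `rad q` is linearly independent over `ℂ`, so the real span of its image under an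
injective linear map has the rank of `rad q` as dimension. -/
theorem finrank_span_image_rad {V : Type*} [AddCommGroup V] [Module ℂ V] [Module ℝ V]
    [IsScalarTower ℝ ℂ V] {f : (Fin n → ℂ) →ₗ[ℂ] V} (hf : Function.Injective f) :
    Module.finrank ℝ (Submodule.span ℝ ((fun α => f (toC α)) '' (rad q : Set (Fin n → ℤ)))) =
      corank q := by
  let b := Module.finBasis ℤ (rad q)
  have hb : LinearIndependent ℤ fun i => (b i : Fin n → ℤ) :=
    b.linearIndependent.map' (rad q).subtype (Submodule.ker_subtype _)
  have hc : LinearIndependent ℝ fun i => f (toC (b i : Fin n → ℤ)) :=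
    ((linearIndependent_toC hb).map' f (LinearMap.ker_eq_bot.2 hf)).restrict_scalars' ℝ
  have hs : Submodule.span ℝ ((fun α => f (toC α)) '' (rad q : Set (Fin n → ℤ))) =
      Submodule.span ℝ (Set.range fun i => f (toC (b i : Fin n → ℤ))) := by
    refine le_antisymm (Submodule.span_le.2 ?_) (Submodule.span_mono ?_)
    · rintro _ ⟨σ, hσ, rfl⟩
      have h1 := congrArg Subtype.val (b.sum_repr ⟨σ, hσ⟩)
      simp only [Submodule.coe_sum, Submodule.coe_smul] at h1
      have h2 : toC σ = ∑ i, ((b.repr ⟨σ, hσ⟩ i : ℤ) : ℂ) • toC (b i : Fin n → ℤ) := by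
        conv_lhs => rw [← h1]
        ext j
        simp [toC]
      change f (toC σ) ∈ _
      rw [h2, map_sum]
      refine Submodule.sum_mem _ fun i _ => ?_
      have h3 : f ((((b.repr ⟨σ, hσ⟩ i : ℤ) : ℂ)) • toC (b i : Fin n → ℤ)) =
          ((b.repr ⟨σ, hσ⟩ i : ℤ) : ℝ) • f (toC (b i : Fin n → ℤ)) := by
        rw [map_smul, ← algebraMap_smul ℂ ((b.repr ⟨σ, hσ⟩ i : ℤ) : ℝ)]
        simp
      rw [h3]
      exact Submodule.smul_mem _ _ (Submodule.subset_span ⟨i, rfl⟩)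
    · rintro _ ⟨i, rfl⟩
      exact ⟨_, (b i).2, rfl⟩
  rw [hs, finrank_span_eq_card hc, Fintype.card_fin, corank]

/-- For a connected form, `q⁻¹(1)` is not a disjoint union of two non-empty mutually orthogonal
subsets: adjacent simple roots lie in the same part, hence one part contains all simple roots, and
any element of the other part is orthogonal to these. -/
theorem irreducible_of_connected (hu : IsUnitForm q) (hc : IsConnected q)
    {S T : Set (Fin n → ℤ)} (hST : S ∪ T = q ⁻¹' {1})
    (hS : S.Nonempty) (hT : T.Nonempty)
    (horth : ∀ α ∈ S, ∀ β ∈ T, QuadraticMap.polar q α β = 0) : False := by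
  have hmem : ∀ i, (Pi.single i 1 : Fin n → ℤ) ∈ S ∪ T := by
    intro i
    rw [hST]
    exact map_single hu i
  have hedge : ∀ {i j}, (graph q).Adj i j → (Pi.single i 1 : Fin n → ℤ) ∈ S →
      (Pi.single j 1 : Fin n → ℤ) ∈ S := fun {i j} hij hi =>
    (hmem j).resolve_right fun hj => hij.2 (horth _ hi _ hj)
  have hwalk : ∀ {i j}, (graph q).Walk i j → (Pi.single i 1 : Fin n → ℤ) ∈ S →
      (Pi.single j 1 : Fin n → ℤ) ∈ S := by
    intro i j w
    induction w with
    | nil => exact id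
    | cons h _ ih => exact fun hi => ih (hedge h hi)
  have hmap : ∀ α ∈ S ∪ T, α ∉ rad q := by
    intro α hα
    rw [hST] at hα
    exact not_mem_rad_of_map_ne (by rw [show q α = 1 from hα]; exact one_ne_zero)
  obtain ⟨i₀⟩ := hc.nonempty
  rcases hmem i₀ with h | h
  · have hall : ∀ i, (Pi.single i 1 : Fin n → ℤ) ∈ S := fun i =>
      hwalk (hc.preconnected i₀ i).some h
    obtain ⟨β, hβ⟩ := hT
    refine hmap β (Or.inr hβ) (mem_rad_of_polar_single fun i => ?_)
    rw [QuadraticMap.polar_comm, horth _ (hall i) _ hβ]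
  · obtain ⟨α, hα⟩ := hS
    refine hmap α (Or.inl hα) (mem_rad_of_polar_single fun i => ?_)
    rcases hmem i with hi | hi
    · -- `i` would be connected to `i₀` inside `S`
      have hi₀ := hwalk (hc.preconnected i i₀).some hi
      have := horth _ hi₀ _ h
      rw [polar_self_eq, map_single hu] at this
      norm_num at this
    · exact horth _ hα _ hi

end

section

variable {F : RadFamily q}
  {ρ : (Fin n → ℂ) →ₗ[ℂ] radC q}

variable (F ρ) in
/-- The linear map from `ℂⁿ` to the dual of `E_0` which sends `u` to `(π_0(u), -)`. On integral
vectors it gives the weights. -/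
def weightC : (Fin n → ℂ) →ₗ[ℂ] Module.Dual ℂ (component F 0) :=
  (form F ρ).compl₁₂ (proj F 0) (component F 0).subtype

theorem weightC_toC (α : Fin n → ℤ) :
    weightC F ρ (toC α) = weight F ρ α ∘ₗ (component F 0).subtype := by
  rw [weight_eq_form]
  rfl

theorem weightC_injective (hρ : ∀ v : radC q, ρ (v : Fin n → ℂ) = v) :
    Function.Injective (weightC F ρ) := by
  refine (injective_iff_map_eq_zero _).2 fun u hu => eq_zero_of_bilC_of_dual hρ (fun v => ?_)
    fun ξ => ?_
  · have h := LinearMap.congr_fun hu ⟨_, proj_mem_component_zero v⟩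
    change form F ρ (proj F 0 u) (proj F 0 v) = 0 at h
    rwa [form_proj_proj ρ (zero_mem _) (zero_mem _), if_pos (zero_add 0)] at h
  · have h := LinearMap.congr_fun hu ⟨_, inDual_mem_component_zero ξ⟩
    change form F ρ (proj F 0 u) (inDual F ξ) = 0 at h
    rwa [form_proj_inDual, if_pos rfl] at h

theorem eq_zero_of_form_component_zero (hρ : ∀ v : radC q, ρ (v : Fin n → ℂ) = v) {x : Alg F}
    (hx : x ∈ component F 0) (h : ∀ y ∈ component F 0, form F ρ x y = 0) : x = 0 := by
  obtain ⟨h0, hX⟩ := eq_zero_of_form_degree_zero hρ (fun w => h _ (proj_mem_component_zero w))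
    fun ξ => h _ (inDual_mem_component_zero ξ)
  obtain ⟨v, ξ, rfl⟩ := mem_component_zero.1 hx
  rw [map_add, coordP_proj_zero, coordP_inDual, add_zero, Submodule.Quotient.mk_eq_zero, F.zero,
    Submodule.mem_bot] at h0
  rw [map_add, trdX_proj, trdX_inDual, zero_add] at hX
  rw [h0, hX, map_zero, map_zero, add_zero]

theorem finiteDimensional_component_zero : FiniteDimensional ℂ (component F 0) := by
  rw [component, if_pos rfl]
  infer_instance

end

end

end UnitForm

/-! ### The extended affine structure of `E(q)` -/

theorem LieAlgebra.ad_pow_three_apply {L : Type*} [LieRing L] [LieAlgebra ℂ L] (x y : L) :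
    (LieAlgebra.ad ℂ L x ^ 3) y = ⁅x, ⁅x, ⁅x, y⁆⁆⁆ := by
  simp [pow_succ]

open UnitForm in
theorem theorem3 {n : ℕ} (q : QuadraticForm ℤ (Fin n → ℤ))
    (hunit : UnitForm.IsUnitForm q) (hnonneg : UnitForm.IsNonneg q)
    (hconn : UnitForm.IsConnected q)
    (B : LinearMap.BilinForm ℤ (Fin n → ℤ)) (hB : ∀ x, B x x = q x)
    (ρ : (Fin n → ℂ) →ₗ[ℂ] UnitForm.radC q) (hρ : ∀ v : UnitForm.radC q, ρ (v : Fin n → ℂ) = v) :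
    ∃ hLie : EALA.IsLieBracket (UnitForm.bracket (UnitForm.famE q) B ρ),
      letI : LieRing (UnitForm.E q) := hLie.lieRing
      letI : LieAlgebra ℂ (UnitForm.E q) := hLie.lieAlgebra
      ∃ H : LieSubalgebra ℂ (UnitForm.E q),
        H.toSubmodule = UnitForm.component (UnitForm.famE q) 0 ∧
        EALA.IsExtendedAffine H (UnitForm.form (UnitForm.famE q) ρ) ∧
        ∃ wt : (Fin n → ℤ) →+ Module.Dual ℂ H,
          (∀ α, wt α = UnitForm.weight (UnitForm.famE q) ρ α ∘ₗ H.toSubmodule.subtype) ∧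
          Function.Injective wt ∧
          EALA.roots H = wt '' UnitForm.rootSet q ∧
          (∀ α ∈ UnitForm.rootSet q,
            EALA.rootSpace H (wt α) = UnitForm.component (UnitForm.famE q) α) ∧
          (∀ α β, EALA.dualForm H (UnitForm.form (UnitForm.famE q) ρ) (wt α) (wt β) =
            ((QuadraticMap.polar q α β : ℤ) : ℂ)) ∧
          EALA.nullity H (UnitForm.form (UnitForm.famE q) ρ) = UnitForm.corank q := by
  have hLie := isLieBracket ρ toC_mem_famE hnonneg hB
  refine ⟨hLie, ?_⟩
  let _ : LieRing (UnitForm.E q) := hLie.lieRing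
  let _ : LieAlgebra ℂ (UnitForm.E q) := hLie.lieAlgebra
  have habel : ∀ x ∈ component (famE q) 0, ∀ y ∈ component (famE q) 0, ⁅x, y⁆ = 0 := by
    intro x hx y hy
    change bracket (famE q) B ρ x y = 0
    rw [bracket_of_mem_component hx hy, weight_zero, LinearMap.zero_apply, zero_smul]
  let H : LieSubalgebra ℂ (UnitForm.E q) :=
    { component (famE q) 0 with
      lie_mem' := fun {x y} hx hy => by
        have h := habel x hx y hy
        change ⁅x, y⁆ ∈ component (famE q) 0
        rw [h]
        exact zero_mem _ }
  let f : (Fin n → ℂ) →ₗ[ℂ] Module.Dual ℂ H := weightC (famE q) ρ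
  have hf : Function.Injective f := weightC_injective hρ
  let wt : (Fin n → ℤ) →+ Module.Dual ℂ H :=
    { toFun := fun α => f (toC α)
      map_zero' := by rw [toC_zero, map_zero]
      map_add' := fun α β => by rw [toC_add, map_add] }
  have hwt' : ∀ α (h : H), wt α h = weight (famE q) ρ α h := fun α h =>
    LinearMap.congr_fun (weightC_toC (F := famE q) (ρ := ρ) α) h
  have hinj : Function.Injective wt := hf.comp toC_injective
  obtain ⟨i₀⟩ := hconn.nonempty
  have hspace : ∀ α, EALA.rootSpace H (wt α) = component (famE q) α := by
    intro α
    ext x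
    rw [mem_component_iff (B := B) hρ]
    constructor
    · intro hx h hh
      have := hx ⟨h, hh⟩
      rw [hwt'] at this
      exact this
    · intro hx h
      rw [hwt']
      exact hx h h.2
  have hroots : EALA.roots H = wt '' rootSet q := by
    ext b
    constructor
    · intro hb
      obtain ⟨x, hx, hx0⟩ := (Submodule.ne_bot_iff _).1 hb
      classical
      obtain ⟨α, hα, h⟩ := exists_root_of_eigenvector (B := B) (ρ := ρ)
        -- the eigenvalue, given on `H` only, is extended by zero
        (b := fun h => if hh : h ∈ component (famE q) 0 then b ⟨h, hh⟩ else 0) (x := x)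
        (fun h hh => by rw [dif_pos hh]; exact hx ⟨h, hh⟩) hx0
      refine ⟨α, hα, LinearMap.ext fun y => ?_⟩
      have hy := h y y.2
      rw [dif_pos (show (y : E q) ∈ component (famE q) 0 from y.2)] at hy
      rw [hwt', ← hy]
    · rintro ⟨α, hα, rfl⟩
      change EALA.rootSpace H (wt α) ≠ ⊥
      rw [hspace]
      exact component_ne_bot hnonneg hunit i₀ hα
  -- the transferred form: `wt α` is represented by `π_0(α)`
  have hdual_inj : Function.Injective (EALA.toDual H (form (famE q) ρ)) := by
    refine (injective_iff_map_eq_zero _).2 fun x hx => Subtype.ext ?_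
    exact eq_zero_of_form_component_zero hρ x.2 fun y hy => LinearMap.congr_fun hx ⟨y, hy⟩
  have hrep : ∀ α, Function.invFun (EALA.toDual H (form (famE q) ρ)) (wt α) =
      ⟨proj (famE q) 0 (toC α), proj_mem_component_zero _⟩ := fun α =>
    Function.leftInverse_invFun hdual_inj ⟨proj (famE q) 0 (toC α), proj_mem_component_zero _⟩
  have hdual : ∀ α β, EALA.dualForm H (form (famE q) ρ) (wt α) (wt β) =
      ((QuadraticMap.polar q α β : ℤ) : ℂ) := by
    intro α β
    rw [EALA.dualForm, hrep, hrep]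
    change form (famE q) ρ (proj (famE q) 0 (toC α)) (proj (famE q) 0 (toC β)) = _
    rw [form_proj_proj ρ (zero_mem _) (zero_mem _), if_pos (zero_add 0), bilC_toC]
  have hself : ∀ α, EALA.dualForm H (form (famE q) ρ) (wt α) (wt α) = 0 ↔ q α = 0 := by
    intro α
    rw [hdual, polar_self_eq]
    norm_cast
    omega
  have hiso : EALA.isotropicRoots H (form (famE q) ρ) = wt '' (rad q : Set (Fin n → ℤ)) := by
    ext b
    constructor
    · rintro ⟨hb, h0⟩
      rw [hroots] at hb
      obtain ⟨α, -, rfl⟩ := hb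
      exact ⟨α, (mem_rad_iff hnonneg).2 ((hself α).1 h0), rfl⟩
    · rintro ⟨α, hα, rfl⟩
      have h0 : q α = 0 := map_of_mem_rad hα
      refine ⟨?_, (hself α).2 h0⟩
      rw [hroots]
      exact ⟨α, Or.inl h0, rfl⟩
  have haniso : EALA.nonisotropicRoots H (form (famE q) ρ) = wt '' (q ⁻¹' {1}) := by
    ext b
    constructor
    · rintro ⟨hb, h0⟩
      rw [hroots] at hb
      obtain ⟨α, hα, rfl⟩ := hb
      exact ⟨α, hα.resolve_left fun h => h0 ((hself α).2 h), rfl⟩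
    · rintro ⟨α, hα, rfl⟩
      have h1 : q α = 1 := hα
      refine ⟨?_, fun h => ?_⟩
      · rw [hroots]
        exact ⟨α, Or.inr h1, rfl⟩
      · rw [(hself α).1 h] at h1
        exact zero_ne_one h1
  refine ⟨H, rfl, ?_, wt, fun α => weightC_toC α, hinj, hroots, fun α _ => hspace α, hdual, ?_⟩
  · constructor
    · exact ⟨form_symm ρ⟩
    · exact ⟨fun x hx => form_separating hρ hx,
        fun x hx => form_separating hρ fun y => (form_symm ρ x y).trans (hx y)⟩
    · exact form_bracket_invariant ρ toC_mem_famE hnonneg hB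
    · intro h
      refine proj_single_ne_zero (F := famE q) hunit i₀ (zero_mem _) ?_
      have hm : proj (famE q) 0 (toC (Pi.single i₀ 1)) ∈ H := proj_mem_component_zero _
      rw [h] at hm
      exact hm
    · exact finiteDimensional_component_zero (F := famE q)
    · exact habel
    · intro x
      change x ∈ component (famE q) 0 ↔ _
      rw [mem_component_iff (B := B) hρ]
      simp only [weight_zero, LinearMap.zero_apply, zero_smul]
      rfl
    · exact fun h hh => iSup_eigenspace_eq_top hh
    · rw [haniso]
      rintro _ ⟨α, hα, rfl⟩ x hx y
      rw [hspace] at hx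
      have h1 : q α = 1 := hα
      refine ⟨3, by norm_num, ?_⟩
      rw [LieAlgebra.ad_pow_three_apply]
      exact bracket_component_cube hnonneg h1 hx y
    · rw [hroots]
      exact isDiscrete_image_toC hf (rootSet q)
    · rintro ⟨R₁, R₂, ⟨b₁, h₁⟩, ⟨b₂, h₂⟩, -, hunion, horth⟩
      rw [haniso] at hunion
      have hpre : wt ⁻¹' R₁ ∪ wt ⁻¹' R₂ = q ⁻¹' {1} := by
        rw [← Set.preimage_union, hunion, Set.preimage_image_eq _ hinj]
      have hlift : ∀ b ∈ R₁ ∪ R₂, ∃ α, wt α = b := by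
        intro b hb
        rw [hunion] at hb
        obtain ⟨α, -, h⟩ := hb
        exact ⟨α, h⟩
      obtain ⟨α₁, rfl⟩ := hlift b₁ (Or.inl h₁)
      obtain ⟨α₂, rfl⟩ := hlift b₂ (Or.inr h₂)
      refine irreducible_of_connected hunit hconn hpre ⟨α₁, h₁⟩ ⟨α₂, h₂⟩ fun α hα β hβ => ?_
      have h := horth _ hα _ hβ
      rw [hdual] at h
      exact_mod_cast h
  · rw [EALA.nullity, hiso]
    have h := finrank_span_image_rad (q := q) (V := Module.Dual ℂ H) (f := f) hf
    exact h
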